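/- Let $I=[0,1]$. Let $C(I)$ be the space of subcontinua (nonempty compact connected subsets) of $I$, with the Vietoris topology, and let $\Phi(I)\subseteq C(C(I))$ be the space of maximal connected chains of $I$, that is, of those subcontinua $\mathcal C$ of $C(I)$ which are maximal families of subcontinua of $I$ linearly ordered by inclusion. The homeomorphism group $\mathrm{Homeo}(I)$ acts on $\Phi(I)$ by $h\cdot\mathcal C=\{h[C]: C\in\mathcal C\}$. For a countable relational language $\mathcal L$, let $\mathrm{Mod}(\mathcal L)$ be the space of $\mathcal L$-structures with domain $\mathbb N$, identified with $\prod_{R\in\mathcal L}2^{\mathbb N^{n(R)}}$, where $n(R)$ is the arity of $R$. (1) Chains on $[0,1]$ are classifiable by countable structures: there are a countable relational language $\mathcal L$ and a Borel map $f\colon\Phi(I)\to\mathrm{Mod}(\mathcal L)$ such that for all $\mathcal C,\mathcal C'\in\Phi(I)$, $$\mathcal C'\in\mathrm{Homeo}(I)\cdot\mathcal C\iff f(\mathcal C)\cong f(\mathcal C').$$ (2) For orientation-preserving homeomorphisms, the coding can be given by the maximal subchains. A subchain of $\mathcal C$ is a closed connected subset $\mathcal I\subseteq\mathcal C$; a subchain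 $\mathcal I$ with more than one element is horizontal if all $[x,y]\in\mathcal I$ have the same $y$, vertical if they all have the same $x$, and strictly monotone if $x=x'\Leftrightarrow y=y'$ for all $[x,y],[x',y']\in\mathcal I$. It is maximal horizontal (vertical, strictly monotone) if it is maximal under inclusion among the subchains of $\mathcal C$ of that type; a maximal subchain is one that is maximal of one of the three types. Let $\mathcal L=\{P_H,P_V,P_S,<\}$ with three unary symbols and one binary symbol. There is a Borel map $\mathcal M\colon\Phi(I)\to\mathrm{Mod}(\mathcal L)$ such that: (a) for every $\mathcal C$ there is an injective enumeration $(e_n)_{n\in N}$, with $N\subseteq\mathbb N$, of the maxima (with respect to inclusion) of the maximal subchains of $\mathcal C$, with $N=\mathbb N$ if there are infinitely many, such that in $\mathcal M(\mathcal C)$ the relation $P_H(n)$ (respectively $P_V(n)$, $P_S(n)$) holds if and only if $n\in N$ and $e_n$ is the maximum of a maximal horizontal (respectively vertical, strictly monotone) subchain of $\mathcal C$, and $n<m$ holds if and only if $n,m\in N$ and $e_n\subseteq e_m$ (so that $<$ is read reflexively); (b) for all $\mathcal C,\mathcal C'\in\Phi(I)$, there is an increasing homeomorphism $h$ of $I$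 with $\mathcal C'=h\cdot\mathcal C$ if and only if $\mathcal M(\mathcal C)\cong\mathcal M(\mathcal C')$. -/

import Mathlib

open TopologicalSpace

/-! ## Hyperspaces of subcontinua and maximal connected chains -/

/-- The space `C(X)` of subcontinua of `X`: the nonempty compact connected subsets of `X`, ordered by
inclusion and with the topology induced by the Vietoris topology of Mathlib on the nonempty compact
sets. -/
abbrev Subcontinuum (X : Type*) [TopologicalSpace X] : Type _ :=
  {K : NonemptyCompacts X // IsConnected (K : Set X)}

/-- The space `Φ(X)` of maximal connected chains of `X`, as a subspace of `C(C(X))`: an element is a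
subcontinuum `𝒞` of `C(X)` which is a maximal chain of subcontinua with respect to inclusion. -/
abbrev MaximalChain (X : Type*) [TopologicalSpace X] : Type _ :=
  {𝒞 : Subcontinuum (Subcontinuum X) //
    IsMaxChain (· ≤ ·) ((𝒞 : NonemptyCompacts (Subcontinuum X)) : Set (Subcontinuum X))}

/-- The set of subcontinua belonging to a maximal connected chain. -/
def MaximalChain.carrier {X : Type*} [TopologicalSpace X] (𝒞 : MaximalChain X) :
    Set (Subcontinuum X) :=
  ((𝒞 : Subcontinuum (Subcontinuum X)) : NonemptyCompacts (Subcontinuum X))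

/-- The image `f[K]` of a subcontinuum under a continuous map. -/
def Subcontinuum.map {X Y : Type*} [TopologicalSpace X] [TopologicalSpace Y] (f : X → Y)
    (hf : Continuous f) (K : Subcontinuum X) : Subcontinuum Y :=
  ⟨K.1.map f hf, by
    rw [NonemptyCompacts.coe_map]
    exact K.2.image f hf.continuousOn⟩

theorem Subcontinuum.coe_map {X Y : Type*} [TopologicalSpace X] [TopologicalSpace Y] (f : X → Y)
    (hf : Continuous f) (K : Subcontinuum X) :
    ((Subcontinuum.map f hf K).1 : Set Y) = f '' (K.1 : Set X) :=
  NonemptyCompacts.coe_map hf K.1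

theorem Subcontinuum.ext {X : Type*} [TopologicalSpace X] {K L : Subcontinuum X}
    (h : (K.1 : Set X) = (L.1 : Set X)) : K = L :=
  Subtype.ext (NonemptyCompacts.ext h)

theorem Subcontinuum.continuous_map {X Y : Type*} [TopologicalSpace X] [TopologicalSpace Y]
    (f : X → Y) (hf : Continuous f) : Continuous (Subcontinuum.map f hf) :=
  (hf.nonemptyCompacts_map.comp continuous_subtype_val).subtype_mk _

/-- A homeomorphism of `X` acts on the subcontinua of `X` as an automorphism of the inclusion
order. -/
def Subcontinuum.mapRelIso {X : Type*} [TopologicalSpace X] (h : X ≃ₜ X) :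
    ((· ≤ ·) : Subcontinuum X → Subcontinuum X → Prop) ≃r
      ((· ≤ ·) : Subcontinuum X → Subcontinuum X → Prop) where
  toFun := Subcontinuum.map h h.continuous
  invFun := Subcontinuum.map h.symm h.symm.continuous
  left_inv K := Subcontinuum.ext (by
    rw [Subcontinuum.coe_map, Subcontinuum.coe_map, Set.image_image]
    simp)
  right_inv K := Subcontinuum.ext (by
    rw [Subcontinuum.coe_map, Subcontinuum.coe_map, Set.image_image]
    simp)
  map_rel_iff' {K L} := by
    change ((Subcontinuum.map h h.continuous K).1 : Set X) ⊆
      ((Subcontinuum.map h h.continuous L).1 : Set X) ↔ (K.1 : Set X) ⊆ (L.1 : Set X)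
    rw [Subcontinuum.coe_map, Subcontinuum.coe_map]
    exact Set.image_subset_image_iff h.injective

/-- The action of a homeomorphism on maximal connected chains, `h • 𝒞 = {h[C] : C ∈ 𝒞}`. -/
def MaximalChain.map {X : Type*} [TopologicalSpace X] (h : X ≃ₜ X) (𝒞 : MaximalChain X) :
    MaximalChain X :=
  ⟨Subcontinuum.map (Subcontinuum.map h h.continuous) (Subcontinuum.continuous_map h h.continuous)
      𝒞.1, by
    rw [Subcontinuum.coe_map]
    exact IsMaxChain.image (Subcontinuum.mapRelIso h) 𝒞.2⟩

theorem MaximalChain.carrier_map {X : Type*} [TopologicalSpace X] (h : X ≃ₜ X)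
    (𝒞 : MaximalChain X) :
    (MaximalChain.map h 𝒞).carrier = Subcontinuum.map h h.continuous '' 𝒞.carrier :=
  Subcontinuum.coe_map _ _ 𝒞.1

theorem MaximalChain.ext {X : Type*} [TopologicalSpace X] {𝒞 𝒟 : MaximalChain X}
    (h : 𝒞.carrier = 𝒟.carrier) : 𝒞 = 𝒟 :=
  Subtype.ext (Subcontinuum.ext h)

/-- The natural action of the homeomorphism group of `X` on the space of maximal connected chains. -/
instance MaximalChain.instMulActionHomeomorph {X : Type*} [TopologicalSpace X] :
    MulAction (X ≃ₜ X) (MaximalChain X) where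
  smul h 𝒞 := MaximalChain.map h 𝒞
  one_smul 𝒞 := MaximalChain.ext (by
    refine (MaximalChain.carrier_map 1 𝒞).trans ?_
    have hid : Subcontinuum.map (1 : X ≃ₜ X) (1 : X ≃ₜ X).continuous = id := by
      funext K
      exact Subcontinuum.ext ((Subcontinuum.coe_map _ _ K).trans (Set.image_id _))
    rw [hid, Set.image_id])
  mul_smul g h 𝒞 := MaximalChain.ext (by
    refine (MaximalChain.carrier_map (g * h) 𝒞).trans ?_
    refine Eq.trans ?_ (MaximalChain.carrier_map g (MaximalChain.map h 𝒞)).symm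
    rw [MaximalChain.carrier_map, Set.image_image]
    congr 1
    funext K
    apply Subcontinuum.ext
    rw [Subcontinuum.coe_map, Subcontinuum.coe_map, Subcontinuum.coe_map, Set.image_image]
    rfl)

/-! ## Classifiability by countable structures -/

/-- The space `Mod(L)` of structures with domain `ℕ` for the relation symbols of `L`: the product of
the spaces `2 ^ (ℕ ^ n)` over all relation symbols, `n` being the arity. As `Bool` carries the
discrete topology, the topology is the usual product topology. -/
abbrev CodedStructure (L : FirstOrder.Language.{0, 0}) : Type :=
  (R : Σ n, L.Relations n) → (Fin R.1 → ℕ) → Bool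

/-- The `L`-structure on `ℕ` given by a point of `Mod(L)`. -/
@[reducible]
def CodedStructure.toStructure {L : FirstOrder.Language.{0, 0}} [L.IsRelational] (M : CodedStructure L) :
    L.Structure ℕ where
  funMap f _ := isEmptyElim f
  RelMap R x := M ⟨_, R⟩ x = true

/-- Isomorphism of structures with domain `ℕ`. -/
def CodedStructure.Isomorphic {L : FirstOrder.Language.{0, 0}} [L.IsRelational] (M N : CodedStructure L) :
    Prop :=
  Nonempty (@FirstOrder.Language.Equiv L ℕ ℕ M.toStructure N.toStructure)

/-- A map between topological spaces is Borel if it is measurable for the Borel σ-algebras. -/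
def IsBorelMap {Y Z : Type*} [TopologicalSpace Y] [TopologicalSpace Z] (f : Y → Z) : Prop :=
  @Measurable Y Z (borel Y) (borel Z) f

/-- An equivalence relation on a (Polish) space is classifiable by countable structures if it is
Borel reducible to the isomorphism relation on `Mod(L)`, for some countable relational `L`. -/
def ClassifiableByCountableStructures {Y : Type*} [TopologicalSpace Y] (E : Setoid Y) : Prop :=
  ∃ (L : FirstOrder.Language.{0, 0}) (_ : L.IsRelational),
    Countable (Σ n, L.Relations n) ∧
      ∃ f : Y → CodedStructure L, IsBorelMap f ∧
        ∀ y y' : Y, E y y' ↔ (f y).Isomorphic (f y')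

/-! ## Maximal subchains of a chain on the unit interval -/

/-- The left endpoint `x` of a subcontinuum `[x, y]` of the unit interval. -/
noncomputable def Subcontinuum.left (K : Subcontinuum unitInterval) : ℝ :=
  sInf (Subtype.val '' (K.1 : Set unitInterval))

/-- The right endpoint `y` of a subcontinuum `[x, y]` of the unit interval. -/
noncomputable def Subcontinuum.right (K : Subcontinuum unitInterval) : ℝ :=
  sSup (Subtype.val '' (K.1 : Set unitInterval))

/-- The three types of subchains, named after their shape when `[x, y]` is drawn as the point
`(x, y)` of the plane. -/
inductive SubchainKind : Type
  | horizontal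
  | vertical
  | strictlyMonotone

/-- The condition on the endpoints which defines each type of subchains. -/
def SubchainKind.Holds : SubchainKind → Set (Subcontinuum unitInterval) → Prop
  | horizontal, ℐ => ∀ A ∈ ℐ, ∀ B ∈ ℐ, A.right = B.right
  | vertical, ℐ => ∀ A ∈ ℐ, ∀ B ∈ ℐ, A.left = B.left
  | strictlyMonotone, ℐ => ∀ A ∈ ℐ, ∀ B ∈ ℐ, (A.left = B.left ↔ A.right = B.right)

/-- `ℐ` is a subchain of `𝒞` (a closed connected subset) which is non-trivial (it has more than one
element) and of type `k`. -/
structure IsSubchainOfKind (𝒞 : MaximalChain unitInterval) (k : SubchainKind)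
    (ℐ : Set (Subcontinuum unitInterval)) : Prop where
  subset : ℐ ⊆ 𝒞.carrier
  isClosed : IsClosed ℐ
  isConnected : IsConnected ℐ
  nontrivial : ℐ.Nontrivial
  holds : k.Holds ℐ

/-- `ℐ` is a maximal horizontal / vertical / strictly monotone subchain of `𝒞`. -/
def IsMaximalSubchain (𝒞 : MaximalChain unitInterval) (k : SubchainKind)
    (ℐ : Set (Subcontinuum unitInterval)) : Prop :=
  Maximal (IsSubchainOfKind 𝒞 k) ℐ

/-- The set of the maxima of all maximal subchains of type `k` of `𝒞`. -/
def subchainTops (𝒞 : MaximalChain unitInterval) (k : SubchainKind) :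
    Set (Subcontinuum unitInterval) :=
  {A | ∃ ℐ, IsMaximalSubchain 𝒞 k ℐ ∧ IsGreatest ℐ A}

/-- The relation symbols of the language of subchains: a unary predicate for each of the three types
and a binary relation for the order. -/
inductive SubchainRelation : ℕ → Type
  | kind (k : SubchainKind) : SubchainRelation 1
  | below : SubchainRelation 2

/-- The relational language `{P_H, P_V, P_S, <}`. -/
def subchainLanguage : FirstOrder.Language.{0, 0} where
  Functions _ := Empty
  Relations := SubchainRelation

instance subchainLanguage.instIsRelational : subchainLanguage.IsRelational :=
  fun _ => Empty.instIsEmpty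

/-- `M` is a structure on `ℕ` which records the maximal subchains of `𝒞`, their types and their
order. The sequence `e` restricts to an injective enumeration, by the indices in `N`, of the maxima
of the maximal subchains; all natural numbers are used as indices when there are infinitely many
maximal subchains, and indices outside `N` satisfy no relation. -/
def RecordsSubchains (M : CodedStructure subchainLanguage) (𝒞 : MaximalChain unitInterval) : Prop :=
  ∃ (N : Set ℕ) (e : ℕ → Subcontinuum unitInterval),
    Set.BijOn e N (⋃ k, subchainTops 𝒞 k) ∧
    (N.Infinite → N = Set.univ) ∧
    (∀ (k : SubchainKind) (n : ℕ),
      M ⟨1, SubchainRelation.kind k⟩ ![n] = true ↔ n ∈ N ∧ e n ∈ subchainTops 𝒞 k) ∧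
    (∀ n m : ℕ,
      M ⟨2, SubchainRelation.below⟩ ![n, m] = true ↔ n ∈ N ∧ m ∈ N ∧ e n ≤ e m)

/-!
A maximal chain of subcontinua of `[0, 1]` contains exactly one element of each length `t ∈ [0, 1]`
(`MaximalChain.elt`), and this parametrization is a homeomorphism onto the chain. The chain is thus
given by two continuous functions of `t`, the left endpoint, which is antitone, and the right
endpoint, which is monotone. A subchain is an interval of lengths: horizontal if the right endpoint
is constant on it, vertical if the left endpoint is, and strictly monotone if both endpoints are
injective on it. Every nondegenerate interval of lengths contains a nondegenerate interval of one of
these types, no such interval has two types, and each extends to a maximal one. Hence the maximal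
intervals do not overlap and have a dense union (`IsIntervalSystem`,
`MaximalChain.isIntervalSystem_runs`).

An order isomorphism between the maximal intervals of two chains is induced by an order
automorphism `τ` of the space of lengths: give each maximal interval a positive weight, with a finite
sum of all weights, and change the scale on both sides so that the length of each interval becomes
its weight (`exists_orderIso_of_intervals`). If the types are preserved too, then an endpoint of the
first chain is constant between two lengths `s` and `t` if and only if the corresponding endpoint of
the second chain is constant between `τ s` and `τ t`. So sending the endpoints at `t` to the endpoints
at `τ t` is a well-defined increasing bijection of `[0, 1]`
(`MaximalChain.exists_homeomorph_of_timeChange`). Conversely, an increasing homeomorphism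
preserves the types of subchains. Any two structures which record the maximal subchains of two
chains are therefore isomorphic if and only if an increasing homeomorphism maps one chain to the
other (`RecordsSubchains.exists_strictMono_iff`).

A decreasing homeomorphism exchanges horizontal and vertical subchains. For the action of all
homeomorphisms it is enough to replace the two predicates for these types by the relation of both
being horizontal or both being vertical, as a bijection preserves this relation only if it
preserves or exchanges the two types (`preserves_or_exchanges`,
`RecordsSubchains.exists_homeomorph_iff`).

For the Borel measurable choice of the structures, each maximal subchain is represented by the first
point of a fixed dense sequence of lengths which lies inside its interval
(`MaximalChain.subchainStructure`). Which points these are depends only on comparisons of the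
endpoints at the lengths of the dense sequence, and the endpoints at a given length are Borel
functions of the chain, since the chains which meet a given closed set of subcontinua form a closed
set.
-/

/-! ### Subcontinua of the unit interval as closed intervals -/

namespace Subcontinuum

/-- The least point of a subcontinuum of the unit interval, as a point of the interval. -/
noncomputable def lo (K : Subcontinuum unitInterval) : unitInterval := sInf (K.1 : Set unitInterval)

/-- The greatest point of a subcontinuum of the unit interval, as a point of the interval. -/
noncomputable def hi (K : Subcontinuum unitInterval) : unitInterval := sSup (K.1 : Set unitInterval)

theorem coe_eq_Icc (K : Subcontinuum unitInterval) :
    (K.1 : Set unitInterval) = Set.Icc K.lo K.hi :=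
  eq_Icc_of_connected_compact K.2 K.1.isCompact

theorem lo_le_hi (K : Subcontinuum unitInterval) : K.lo ≤ K.hi :=
  Set.nonempty_Icc.1 (K.coe_eq_Icc ▸ K.1.nonempty)

theorem lo_eq_of_coe_eq {K : Subcontinuum unitInterval} {a b : unitInterval} (hab : a ≤ b)
    (h : (K.1 : Set unitInterval) = Set.Icc a b) : K.lo = a := by
  rw [lo, h, csInf_Icc hab]

theorem hi_eq_of_coe_eq {K : Subcontinuum unitInterval} {a b : unitInterval} (hab : a ≤ b)
    (h : (K.1 : Set unitInterval) = Set.Icc a b) : K.hi = b := by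
  rw [hi, h, csSup_Icc hab]

theorem left_eq (K : Subcontinuum unitInterval) : K.left = K.lo := by
  rw [left, coe_eq_Icc]
  exact IsLeast.csInf_eq ⟨⟨_, Set.left_mem_Icc.2 K.lo_le_hi, rfl⟩, by
    rintro _ ⟨x, hx, rfl⟩
    exact hx.1⟩

theorem right_eq (K : Subcontinuum unitInterval) : K.right = K.hi := by
  rw [right, coe_eq_Icc]
  exact IsGreatest.csSup_eq ⟨⟨_, Set.right_mem_Icc.2 K.lo_le_hi, rfl⟩, by
    rintro _ ⟨x, hx, rfl⟩
    exact hx.2⟩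

theorem le_iff {K L : Subcontinuum unitInterval} : K ≤ L ↔ L.lo ≤ K.lo ∧ K.hi ≤ L.hi := by
  change (K.1 : Set unitInterval) ⊆ L.1 ↔ _
  rw [coe_eq_Icc, coe_eq_Icc, Set.Icc_subset_Icc_iff K.lo_le_hi]

theorem ext_lo_hi {K L : Subcontinuum unitInterval} (h₁ : K.lo = L.lo) (h₂ : K.hi = L.hi) :
    K = L :=
  le_antisymm (le_iff.2 ⟨h₁.ge, h₂.le⟩) (le_iff.2 ⟨h₁.le, h₂.ge⟩)

theorem lo_lt_iff {K : Subcontinuum unitInterval} {a : unitInterval} :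
    K.lo < a ↔ ((K.1 : Set unitInterval) ∩ Set.Iio a).Nonempty := by
  rw [coe_eq_Icc]
  exact ⟨fun h => ⟨K.lo, Set.left_mem_Icc.2 K.lo_le_hi, h⟩, fun ⟨x, hx, hxa⟩ => hx.1.trans_lt hxa⟩

theorem lt_lo_iff {K : Subcontinuum unitInterval} {a : unitInterval} :
    a < K.lo ↔ (K.1 : Set unitInterval) ⊆ Set.Ioi a := by
  rw [coe_eq_Icc]
  exact ⟨fun h x hx => h.trans_le hx.1, fun h => h (Set.left_mem_Icc.2 K.lo_le_hi)⟩

theorem lt_hi_iff {K : Subcontinuum unitInterval} {a : unitInterval} :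
    a < K.hi ↔ ((K.1 : Set unitInterval) ∩ Set.Ioi a).Nonempty := by
  rw [coe_eq_Icc]
  exact ⟨fun h => ⟨K.hi, Set.right_mem_Icc.2 K.lo_le_hi, h⟩, fun ⟨x, hx, hxa⟩ => hxa.trans_le hx.2⟩

theorem hi_lt_iff {K : Subcontinuum unitInterval} {a : unitInterval} :
    K.hi < a ↔ (K.1 : Set unitInterval) ⊆ Set.Iio a := by
  rw [coe_eq_Icc]
  exact ⟨fun h x hx => hx.2.trans_lt h, fun h => h (Set.right_mem_Icc.2 K.lo_le_hi)⟩

theorem isOpen_setOf_subset {X : Type*} [TopologicalSpace X] {U : Set X} (hU : IsOpen U) :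
    IsOpen {K : Subcontinuum X | (K.1 : Set X) ⊆ U} :=
  (NonemptyCompacts.isOpen_subsets_of_isOpen hU).preimage continuous_subtype_val

theorem isOpen_setOf_inter_nonempty {X : Type*} [TopologicalSpace X] {U : Set X} (hU : IsOpen U) :
    IsOpen {K : Subcontinuum X | ((K.1 : Set X) ∩ U).Nonempty} :=
  (NonemptyCompacts.isOpen_inter_nonempty_of_isOpen hU).preimage continuous_subtype_val

theorem isClosed_setOf_inter_nonempty {X : Type*} [TopologicalSpace X] {F : Set X}
    (hF : IsClosed F) : IsClosed {K : Subcontinuum X | ((K.1 : Set X) ∩ F).Nonempty} :=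
  (NonemptyCompacts.isClosed_inter_nonempty_of_isClosed hF).preimage continuous_subtype_val

theorem continuous_lo : Continuous lo := by
  refine OrderTopology.continuous_iff.2 fun a => ⟨?_, ?_⟩
  · convert isOpen_setOf_subset (isOpen_Ioi (a := a)) using 1
    exact Set.ext fun K => lt_lo_iff
  · convert isOpen_setOf_inter_nonempty (isOpen_Iio (a := a)) using 1
    exact Set.ext fun K => lo_lt_iff

theorem continuous_hi : Continuous hi := by
  refine OrderTopology.continuous_iff.2 fun a => ⟨?_, ?_⟩
  · convert isOpen_setOf_inter_nonempty (isOpen_Ioi (a := a)) using 1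
    exact Set.ext fun K => lt_hi_iff
  · convert isOpen_setOf_subset (isOpen_Iio (a := a)) using 1
    exact Set.ext fun K => hi_lt_iff

/-- The length of a subcontinuum of the unit interval, as a point of the interval. -/
noncomputable def length (K : Subcontinuum unitInterval) : unitInterval :=
  ⟨K.hi - K.lo, sub_nonneg.2 K.lo_le_hi, by linarith [K.hi.2.2, K.lo.2.1]⟩

theorem coe_length (K : Subcontinuum unitInterval) : (K.length : ℝ) = K.hi - K.lo := rfl

theorem continuous_length : Continuous length :=
  ((continuous_subtype_val.comp continuous_hi).sub
    (continuous_subtype_val.comp continuous_lo)).subtype_mk _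

theorem eq_of_le_of_length_le {K L : Subcontinuum unitInterval} (h : K ≤ L)
    (hl : L.length ≤ K.length) : K = L := by
  have h' := le_iff.1 h
  have h₁ : (L.lo : ℝ) ≤ K.lo := h'.1
  have h₂ : (K.hi : ℝ) ≤ L.hi := h'.2
  have h₃ : (L.hi : ℝ) - L.lo ≤ K.hi - K.lo := hl
  exact ext_lo_hi (Subtype.ext (by linarith)) (Subtype.ext (by linarith))

theorem lo_map_of_monotone {f : unitInterval → unitInterval} (hf : Continuous f)
    (hm : Monotone f) (K : Subcontinuum unitInterval) : (map f hf K).lo = f K.lo := by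
  refine IsLeast.csInf_eq ?_
  rw [coe_map, coe_eq_Icc]
  exact ⟨⟨_, Set.left_mem_Icc.2 K.lo_le_hi, rfl⟩, by rintro _ ⟨x, hx, rfl⟩; exact hm hx.1⟩

theorem hi_map_of_monotone {f : unitInterval → unitInterval} (hf : Continuous f)
    (hm : Monotone f) (K : Subcontinuum unitInterval) : (map f hf K).hi = f K.hi := by
  refine IsGreatest.csSup_eq ?_
  rw [coe_map, coe_eq_Icc]
  exact ⟨⟨_, Set.right_mem_Icc.2 K.lo_le_hi, rfl⟩, by rintro _ ⟨x, hx, rfl⟩; exact hm hx.2⟩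

theorem lo_map_of_antitone {f : unitInterval → unitInterval} (hf : Continuous f)
    (hm : Antitone f) (K : Subcontinuum unitInterval) : (map f hf K).lo = f K.hi := by
  refine IsLeast.csInf_eq ?_
  rw [coe_map, coe_eq_Icc]
  exact ⟨⟨_, Set.right_mem_Icc.2 K.lo_le_hi, rfl⟩, by rintro _ ⟨x, hx, rfl⟩; exact hm hx.2⟩

theorem hi_map_of_antitone {f : unitInterval → unitInterval} (hf : Continuous f)
    (hm : Antitone f) (K : Subcontinuum unitInterval) : (map f hf K).hi = f K.lo := by
  refine IsGreatest.csSup_eq ?_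
  rw [coe_map, coe_eq_Icc]
  exact ⟨⟨_, Set.left_mem_Icc.2 K.lo_le_hi, rfl⟩, by rintro _ ⟨x, hx, rfl⟩; exact hm hx.1⟩

end Subcontinuum

/-! ### Parametrization of a maximal chain by length -/

namespace MaximalChain

theorem isCompact_carrier {X : Type*} [TopologicalSpace X] (𝒞 : MaximalChain X) :
    IsCompact 𝒞.carrier :=
  𝒞.1.1.isCompact

theorem le_total_of_mem {X : Type*} [TopologicalSpace X] (𝒞 : MaximalChain X)
    {K L : Subcontinuum X} (hK : K ∈ 𝒞.carrier) (hL : L ∈ 𝒞.carrier) : K ≤ L ∨ L ≤ K :=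
  𝒞.2.1.total hK hL

/-- By maximality, a subcontinuum comparable with all elements of the chain belongs to it. -/
theorem mem_of_forall_comparable {X : Type*} [TopologicalSpace X] (𝒞 : MaximalChain X)
    {K : Subcontinuum X} (h : ∀ L ∈ 𝒞.carrier, K ≤ L ∨ L ≤ K) : K ∈ 𝒞.carrier := by
  have hc : IsChain (· ≤ ·) (insert K 𝒞.carrier) := 𝒞.2.1.insert fun L hL _ => h L hL
  have h' : 𝒞.carrier = insert K 𝒞.carrier := 𝒞.2.2 hc (Set.subset_insert _ _)
  rw [h']
  exact Set.mem_insert _ _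

variable (𝒞 : MaximalChain unitInterval)

theorem exists_mem_length_eq_one : ∃ K ∈ 𝒞.carrier, K.length = 1 := by
  let T : Subcontinuum unitInterval := ⟨⟨⟨Set.univ, isCompact_univ⟩, Set.univ_nonempty⟩,
    isConnected_univ⟩
  have hT : (T.1 : Set unitInterval) = Set.Icc 0 1 := unitInterval.univ_eq_Icc
  refine ⟨T, 𝒞.mem_of_forall_comparable fun L _ => Or.inr fun x _ => Set.mem_univ x, ?_⟩
  apply Subtype.ext
  rw [Subcontinuum.coe_length, Subcontinuum.lo_eq_of_coe_eq zero_le_one hT,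
    Subcontinuum.hi_eq_of_coe_eq zero_le_one hT]
  simp

/-- The least element of a maximal chain is a point: any point of it is comparable with all
elements of the chain. -/
theorem exists_mem_length_eq_zero : ∃ K ∈ 𝒞.carrier, K.length = 0 := by
  obtain ⟨K, hK, hmin⟩ := 𝒞.isCompact_carrier.exists_isMinOn 𝒞.1.1.nonempty
    Subcontinuum.continuous_length.continuousOn
  have hle : ∀ L ∈ 𝒞.carrier, K ≤ L := fun L hL => by
    rcases 𝒞.le_total_of_mem hK hL with h | h
    · exact h
    · exact (Subcontinuum.eq_of_le_of_length_le h (hmin hL)).ge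
  let T : Subcontinuum unitInterval := ⟨{K.lo}, by
    rw [NonemptyCompacts.coe_singleton]; exact isConnected_singleton⟩
  have hT : (T.1 : Set unitInterval) = Set.Icc K.lo K.lo := by
    rw [Set.Icc_self]; exact NonemptyCompacts.coe_singleton _
  have hlo := Subcontinuum.lo_eq_of_coe_eq le_rfl hT
  have hhi := Subcontinuum.hi_eq_of_coe_eq le_rfl hT
  refine ⟨T, 𝒞.mem_of_forall_comparable fun L hL => Or.inl (le_trans ?_ (hle L hL)), ?_⟩
  · exact Subcontinuum.le_iff.2 ⟨hlo.ge, hhi.trans_le K.lo_le_hi⟩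
  · apply Subtype.ext
    rw [Subcontinuum.coe_length, hlo, hhi]
    simp

theorem injOn_length : Set.InjOn Subcontinuum.length 𝒞.carrier := fun K hK L hL h => by
  rcases 𝒞.le_total_of_mem hK hL with h' | h'
  · exact Subcontinuum.eq_of_le_of_length_le h' h.ge
  · exact (Subcontinuum.eq_of_le_of_length_le h' h.le).symm

theorem exists_mem_length_eq (t : unitInterval) : ∃ K ∈ 𝒞.carrier, K.length = t := by
  obtain ⟨K, hK, hK0⟩ := 𝒞.exists_mem_length_eq_zero
  obtain ⟨L, hL, hL1⟩ := 𝒞.exists_mem_length_eq_one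
  have := 𝒞.1.2.isPreconnected.intermediate_value hK hL
    Subcontinuum.continuous_length.continuousOn
  rw [hK0, hL1] at this
  exact this ⟨unitInterval.nonneg', unitInterval.le_one'⟩

/-- The element of a maximal chain which has length `t`. -/
noncomputable def elt (t : unitInterval) : Subcontinuum unitInterval :=
  (𝒞.exists_mem_length_eq t).choose

theorem elt_mem (t : unitInterval) : 𝒞.elt t ∈ 𝒞.carrier :=
  (𝒞.exists_mem_length_eq t).choose_spec.1

@[simp]
theorem length_elt (t : unitInterval) : (𝒞.elt t).length = t :=
  (𝒞.exists_mem_length_eq t).choose_spec.2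

theorem elt_length {K : Subcontinuum unitInterval} (hK : K ∈ 𝒞.carrier) : 𝒞.elt K.length = K :=
  𝒞.injOn_length (𝒞.elt_mem _) hK (𝒞.length_elt _)

theorem range_elt : Set.range 𝒞.elt = 𝒞.carrier :=
  Set.Subset.antisymm (Set.range_subset_iff.2 𝒞.elt_mem) fun _ hK => ⟨_, 𝒞.elt_length hK⟩

theorem strictMono_elt : StrictMono 𝒞.elt := by
  have hinj : Function.Injective 𝒞.elt := fun s t h => by
    rw [← 𝒞.length_elt s, h, 𝒞.length_elt]
  refine Monotone.strictMono_of_injective (fun s t hst => ?_) hinj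
  rcases 𝒞.le_total_of_mem (𝒞.elt_mem s) (𝒞.elt_mem t) with h | h
  · exact h
  · exact (Subcontinuum.eq_of_le_of_length_le h (by simpa using hst)).ge

theorem elt_injective : Function.Injective 𝒞.elt := 𝒞.strictMono_elt.injective

theorem continuous_elt : Continuous 𝒞.elt := by
  have : CompactSpace 𝒞.carrier := isCompact_iff_compactSpace.1 𝒞.isCompact_carrier
  let e : 𝒞.carrier ≃ unitInterval :=
    { toFun := fun K => K.1.length
      invFun := fun t => ⟨𝒞.elt t, 𝒞.elt_mem t⟩
      left_inv := fun K => Subtype.ext (𝒞.elt_length K.2)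
      right_inv := 𝒞.length_elt }
  have he : Continuous e := Subcontinuum.continuous_length.comp continuous_subtype_val
  exact continuous_subtype_val.comp (he.homeoOfEquivCompactToT2).symm.continuous

/-- The left endpoint of the element of length `t`. -/
noncomputable def lo (t : unitInterval) : unitInterval := (𝒞.elt t).lo

/-- The right endpoint of the element of length `t`. -/
noncomputable def hi (t : unitInterval) : unitInterval := (𝒞.elt t).hi

theorem continuous_lo : Continuous 𝒞.lo := Subcontinuum.continuous_lo.comp 𝒞.continuous_elt

theorem continuous_hi : Continuous 𝒞.hi := Subcontinuum.continuous_hi.comp 𝒞.continuous_elt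

theorem antitone_lo : Antitone 𝒞.lo := fun _ _ h =>
  (Subcontinuum.le_iff.1 (𝒞.strictMono_elt.monotone h)).1

theorem monotone_hi : Monotone 𝒞.hi := fun _ _ h =>
  (Subcontinuum.le_iff.1 (𝒞.strictMono_elt.monotone h)).2

theorem lo_le_hi (s t : unitInterval) : 𝒞.lo s ≤ 𝒞.hi t :=
  calc 𝒞.lo s ≤ 𝒞.lo 0 := 𝒞.antitone_lo unitInterval.nonneg'
    _ ≤ 𝒞.hi 0 := (𝒞.elt 0).lo_le_hi
    _ ≤ 𝒞.hi t := 𝒞.monotone_hi unitInterval.nonneg'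

theorem coe_hi_sub_lo (t : unitInterval) : (𝒞.hi t : ℝ) - 𝒞.lo t = t :=
  congrArg Subtype.val (𝒞.length_elt t)

theorem lo_zero : 𝒞.lo 0 = 𝒞.hi 0 :=
  Subtype.ext (by have := 𝒞.coe_hi_sub_lo 0; simp only [Set.Icc.coe_zero] at this; linarith)

theorem lo_one : 𝒞.lo 1 = 0 := by
  have := 𝒞.coe_hi_sub_lo 1
  apply Subtype.ext
  simp only [Set.Icc.coe_one, Set.Icc.coe_zero] at *
  linarith [(𝒞.lo 1).2.1, (𝒞.hi 1).2.2]

theorem hi_one : 𝒞.hi 1 = 1 := by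
  have := 𝒞.coe_hi_sub_lo 1
  apply Subtype.ext
  simp only [Set.Icc.coe_one] at *
  linarith [(𝒞.lo 1).2.1, (𝒞.hi 1).2.2]

/-- Both endpoints cannot stay fixed while the length changes. -/
theorem eq_of_lo_eq_of_hi_eq {s t : unitInterval} (h₁ : 𝒞.lo s = 𝒞.lo t) (h₂ : 𝒞.hi s = 𝒞.hi t) :
    s = t :=
  𝒞.elt_injective (Subcontinuum.ext_lo_hi h₁ h₂)

/-- Every point of the interval is an endpoint of some element of the chain. -/
theorem exists_endpoint_eq (z : unitInterval) : (∃ t, 𝒞.lo t = z) ∨ ∃ t, 𝒞.hi t = z := by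
  rcases le_total z (𝒞.lo 0) with h | h
  · refine Or.inl (mem_range_of_exists_le_of_exists_ge 𝒞.continuous_lo ⟨1, ?_⟩ ⟨0, h⟩)
    rw [lo_one]; exact unitInterval.nonneg'
  · refine Or.inr (mem_range_of_exists_le_of_exists_ge 𝒞.continuous_hi ⟨0, ?_⟩ ⟨1, ?_⟩)
    · rwa [← lo_zero]
    · rw [hi_one]; exact unitInterval.le_one'

end MaximalChain

/-! ### Interval systems on the unit interval -/

/-- A family of properties `P k s t` of the intervals `[s, t]` of the unit interval, indexed by
types `k`, for which the nondegenerate intervals of each type can be enlarged to maximal ones, the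
maximal intervals of all types do not overlap, and their union is dense. -/
structure IsIntervalSystem {κ : Type*} (P : κ → unitInterval → unitInterval → Prop) : Prop where
  mono : ∀ {k s s' t' t}, s ≤ s' → s' ≤ t' → t' ≤ t → P k s t → P k s' t'
  join : ∀ {k s t u}, s ≤ t → t ≤ u → P k s t → P k t u → P k s u
  isClosed_left : ∀ k t, IsClosed {s | s ≤ t ∧ P k s t}
  isClosed_right : ∀ k s, IsClosed {t | s ≤ t ∧ P k s t}
  excl : ∀ {k k' s t}, s < t → P k s t → P k' s t → k = k'
  dense : ∀ {s t}, s < t → ∃ k s' t', s ≤ s' ∧ s' < t' ∧ t' ≤ t ∧ P k s' t'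

/-- `[a, b]` is a maximal nondegenerate interval of type `k`. -/
structure IsMaxInterval {κ : Type*} (P : κ → unitInterval → unitInterval → Prop) (k : κ)
    (a b : unitInterval) : Prop where
  lt : a < b
  holds : P k a b
  eq_of_le : ∀ {a' b'}, a' ≤ a → b ≤ b' → P k a' b' → a' = a ∧ b' = b

namespace IsIntervalSystem

variable {κ : Type*} {P : κ → unitInterval → unitInterval → Prop} (hP : IsIntervalSystem P)
include hP

theorem exists_isMaxInterval {k : κ} {s t : unitInterval} (hst : s < t) (h : P k s t) :
    ∃ a b, a ≤ s ∧ t ≤ b ∧ IsMaxInterval P k a b := by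
  obtain ⟨a, ⟨hat, ha⟩, hamin⟩ := (hP.isClosed_left k t).isCompact.exists_isLeast ⟨s, hst.le, h⟩
  obtain ⟨b, ⟨hsb, hb⟩, hbmax⟩ :=
    (hP.isClosed_right k s).isCompact.exists_isGreatest ⟨t, hst.le, h⟩
  have has : a ≤ s := hamin ⟨hst.le, h⟩
  have htb : t ≤ b := hbmax ⟨hst.le, h⟩
  refine ⟨a, b, has, htb, has.trans_lt (hst.trans_le htb),
    hP.join hat htb ha (hP.mono hst.le htb le_rfl hb), fun {a' b'} ha' hb' h' => ?_⟩
  exact ⟨ha'.antisymm (hamin ⟨ha'.trans hat,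
      hP.mono le_rfl (ha'.trans hat) (htb.trans hb') h'⟩),
    (hbmax ⟨hsb.trans hb', hP.mono (ha'.trans has) (hsb.trans hb') le_rfl h'⟩).antisymm hb'⟩

/-- A maximal interval contains every interval of the system which overlaps it. -/
theorem isMaxInterval_contains {k k' : κ} {a b s t : unitInterval}
    (h : IsMaxInterval P k a b) (hst : s < t) (h' : P k' s t)
    (has : a < t) (hsb : s < b) : k = k' ∧ a ≤ s ∧ t ≤ b := by
  have hlt : max a s < min b t := max_lt (lt_min h.lt has) (lt_min hsb hst)
  obtain rfl : k = k' := hP.excl hlt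
    (hP.mono (le_max_left _ _) hlt.le (min_le_left _ _) h.holds)
    (hP.mono (le_max_right _ _) hlt.le (min_le_right _ _) h')
  -- the union of two overlapping intervals of the same type has that type
  have hu : P k (min a s) (max b t) := by
    rcases le_total a s with h₁ | h₁ <;> rcases le_total b t with h₂ | h₂
    · rw [min_eq_left h₁, max_eq_right h₂]
      exact hP.join (h₁.trans hsb.le) h₂ h.holds (hP.mono hsb.le h₂ le_rfl h')
    · rw [min_eq_left h₁, max_eq_left h₂]; exact h.holds
    · rw [min_eq_right h₁, max_eq_right h₂]; exact h'
    · rw [min_eq_right h₁, max_eq_left h₂]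
      exact hP.join (h₁.trans has.le) h₂ h' (hP.mono has.le h₂ le_rfl h.holds)
  obtain ⟨h₁, h₂⟩ := h.eq_of_le (min_le_left _ _) (le_max_left _ _) hu
  exact ⟨rfl, min_eq_left_iff.1 h₁, max_eq_left_iff.1 h₂⟩

theorem isMaxInterval_eq {k k' : κ} {a b a' b' : unitInterval}
    (h : IsMaxInterval P k a b) (h' : IsMaxInterval P k' a' b')
    (h₁ : a < b') (h₂ : a' < b) : k = k' ∧ a = a' ∧ b = b' := by
  have e₁ := hP.isMaxInterval_contains h h'.lt h'.holds h₁ h₂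
  have e₂ := hP.isMaxInterval_contains h' h.lt h.holds h₂ h₁
  exact ⟨e₁.1, e₁.2.1.antisymm e₂.2.1, e₂.2.2.antisymm e₁.2.2⟩

theorem isMaxInterval_eq_of_right_eq {k k' : κ} {a a' b : unitInterval}
    (h : IsMaxInterval P k a b) (h' : IsMaxInterval P k' a' b) : k = k' ∧ a = a' :=
  have e := hP.isMaxInterval_eq h h' h.lt h'.lt
  ⟨e.1, e.2.1⟩

theorem right_le_left_of_lt {k k' : κ} {a b a' b' : unitInterval}
    (h : IsMaxInterval P k a b) (h' : IsMaxInterval P k' a' b') (hb : b < b') : b ≤ a' := by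
  by_contra hlt
  exact hb.ne (hP.isMaxInterval_eq h h' (h.lt.trans hb) (not_le.1 hlt)).2.2

theorem exists_isMaxInterval_inter {s t : unitInterval} (hst : s < t) :
    ∃ k a b, IsMaxInterval P k a b ∧ max a s < min b t := by
  obtain ⟨k, s', t', hs, hlt, ht, h⟩ := hP.dense hst
  obtain ⟨a, b, ha, hb, hm⟩ := hP.exists_isMaxInterval hlt h
  exact ⟨k, a, b, hm, (max_le ha hs).trans_lt (hlt.trans_le (le_min hb ht))⟩

/-- The maximal intervals determine the whole system. -/
theorem iff_exists_isMaxInterval {k : κ} {s t : unitInterval} (hst : s < t) :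
    P k s t ↔ ∃ a b, a ≤ s ∧ t ≤ b ∧ IsMaxInterval P k a b :=
  ⟨hP.exists_isMaxInterval hst, fun ⟨_, _, ha, hb, h⟩ => hP.mono ha hst.le hb h.holds⟩

end IsIntervalSystem

/-! ### The maximal subchains as maximal intervals of lengths -/

namespace MaximalChain

variable (𝒞 : MaximalChain unitInterval)

/-- The elements of `𝒞` with lengths in `[s, t]` form a subchain of type `k`, expressed by the
endpoint functions. The first two cases use that these functions are monotone. -/
def Runs : SubchainKind → unitInterval → unitInterval → Prop
  | .horizontal, s, t => 𝒞.hi s = 𝒞.hi t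
  | .vertical, s, t => 𝒞.lo s = 𝒞.lo t
  | .strictlyMonotone, s, t => ∀ u v, s ≤ u → u < v → v ≤ t → 𝒞.lo u ≠ 𝒞.lo v ∧ 𝒞.hi u ≠ 𝒞.hi v

variable {𝒞}

theorem hi_eq_of_mem_Icc {s t u : unitInterval} (h : 𝒞.hi s = 𝒞.hi t) (hu : u ∈ Set.Icc s t) :
    𝒞.hi u = 𝒞.hi s :=
  ((𝒞.monotone_hi hu.2).trans h.ge).antisymm (𝒞.monotone_hi hu.1)

theorem lo_eq_of_mem_Icc {s t u : unitInterval} (h : 𝒞.lo s = 𝒞.lo t) (hu : u ∈ Set.Icc s t) :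
    𝒞.lo u = 𝒞.lo s :=
  (𝒞.antitone_lo hu.1).antisymm (h.le.trans (𝒞.antitone_lo hu.2))

theorem Runs.mono {k : SubchainKind} {s s' t' t : unitInterval} (hs : s ≤ s') (hst : s' ≤ t')
    (ht : t' ≤ t) (h : 𝒞.Runs k s t) : 𝒞.Runs k s' t' := by
  cases k with
  | horizontal =>
    exact (hi_eq_of_mem_Icc h ⟨hs, hst.trans ht⟩).trans
      (hi_eq_of_mem_Icc h ⟨hs.trans hst, ht⟩).symm
  | vertical =>
    exact (lo_eq_of_mem_Icc h ⟨hs, hst.trans ht⟩).trans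
      (lo_eq_of_mem_Icc h ⟨hs.trans hst, ht⟩).symm
  | strictlyMonotone => exact fun u v hu huv hv => h u v (hs.trans hu) huv (hv.trans ht)

theorem Runs.join {k : SubchainKind} {s t u : unitInterval}
    (h₁ : 𝒞.Runs k s t) (h₂ : 𝒞.Runs k t u) : 𝒞.Runs k s u := by
  cases k with
  | horizontal => exact Eq.trans h₁ h₂
  | vertical => exact Eq.trans h₁ h₂
  | strictlyMonotone =>
    intro x y hx hxy hy
    rcases le_or_gt y t with hyt | hyt
    · exact h₁ x y hx hxy hyt
    rcases le_or_gt t x with hxt | hxt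
    · exact h₂ x y hxt hxy hy
    have h := h₁ x t hx hxt le_rfl
    exact ⟨fun e => h.1 (lo_eq_of_mem_Icc e ⟨hxt.le, hyt.le⟩).symm,
      fun e => h.2 (hi_eq_of_mem_Icc e ⟨hxt.le, hyt.le⟩).symm⟩

/-- Failure of strict monotonicity is witnessed by an interval, which can be shrunk. -/
theorem not_runs_strictlyMonotone_iff {s t : unitInterval} :
    ¬ 𝒞.Runs .strictlyMonotone s t ↔ ∃ u v, s < u ∧ u < v ∧ v < t ∧
      (𝒞.lo u = 𝒞.lo v ∨ 𝒞.hi u = 𝒞.hi v) := by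
  constructor
  · intro h
    simp only [Runs, not_forall] at h
    obtain ⟨u, v, hu, huv, hv, h⟩ := h
    obtain ⟨w, huw, hwv⟩ := exists_between huv
    obtain ⟨w', hww, hwv'⟩ := exists_between hwv
    have hw : w ∈ Set.Icc u v := ⟨huw.le, hwv.le⟩
    have hw' : w' ∈ Set.Icc u v := ⟨(huw.trans hww).le, hwv'.le⟩
    refine ⟨w, w', hu.trans_lt huw, hww, hwv'.trans_le hv, ?_⟩
    by_cases hl : 𝒞.lo u = 𝒞.lo v
    · exact Or.inl ((lo_eq_of_mem_Icc hl hw).trans (lo_eq_of_mem_Icc hl hw').symm)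
    · have hr : 𝒞.hi u = 𝒞.hi v := by by_contra hr; exact h ⟨hl, hr⟩
      exact Or.inr ((hi_eq_of_mem_Icc hr hw).trans (hi_eq_of_mem_Icc hr hw').symm)
  · rintro ⟨u, v, hu, huv, hv, h⟩ hs
    have := hs u v hu.le huv hv.le
    exact h.elim this.1 this.2

variable (𝒞) in
theorem isIntervalSystem_runs : IsIntervalSystem 𝒞.Runs where
  mono := Runs.mono
  join _ _ := Runs.join
  isClosed_left k t := by
    refine isClosed_Iic.inter ?_
    cases k with
    | horizontal => exact isClosed_eq 𝒞.continuous_hi continuous_const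
    | vertical => exact isClosed_eq 𝒞.continuous_lo continuous_const
    | strictlyMonotone =>
      refine isOpen_compl_iff.1 (isOpen_iff_mem_nhds.2 fun s hs => ?_)
      obtain ⟨u, v, hu, h⟩ := not_runs_strictlyMonotone_iff.1 hs
      filter_upwards [Iio_mem_nhds hu] with s' hs'
      exact not_runs_strictlyMonotone_iff.2 ⟨u, v, hs', h⟩
  isClosed_right k s := by
    refine isClosed_Ici.inter ?_
    cases k with
    | horizontal => exact isClosed_eq continuous_const 𝒞.continuous_hi
    | vertical => exact isClosed_eq continuous_const 𝒞.continuous_lo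
    | strictlyMonotone =>
      refine isOpen_compl_iff.1 (isOpen_iff_mem_nhds.2 fun t ht => ?_)
      obtain ⟨u, v, hu, huv, hv, h⟩ := not_runs_strictlyMonotone_iff.1 ht
      filter_upwards [Ioi_mem_nhds hv] with t' ht'
      exact not_runs_strictlyMonotone_iff.2 ⟨u, v, hu, huv, ht', h⟩
  excl {k k' s t} hst h h' := by
    cases k <;> cases k' <;> try rfl
    · exact (hst.ne (𝒞.eq_of_lo_eq_of_hi_eq h' h)).elim
    · exact ((h' s t le_rfl hst le_rfl).2 h).elim
    · exact (hst.ne (𝒞.eq_of_lo_eq_of_hi_eq h h')).elim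
    · exact ((h' s t le_rfl hst le_rfl).1 h).elim
    · exact ((h s t le_rfl hst le_rfl).2 h').elim
    · exact ((h s t le_rfl hst le_rfl).1 h').elim
  dense {s t} hst := by
    by_cases h : 𝒞.Runs .strictlyMonotone s t
    · exact ⟨_, s, t, le_rfl, hst, le_rfl, h⟩
    · obtain ⟨u, v, hu, huv, hv, h | h⟩ := not_runs_strictlyMonotone_iff.1 h
      · exact ⟨.vertical, u, v, hu.le, huv, hv.le, h⟩
      · exact ⟨.horizontal, u, v, hu.le, huv, hv.le, h⟩

/-- For a strictly monotone subchain, the condition `x = x' ↔ y = y'` excludes equality of either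
endpoint at different lengths, since both endpoints cannot agree. -/
theorem holds_image_elt_iff {k : SubchainKind} {s t : unitInterval} (hst : s ≤ t) :
    k.Holds (𝒞.elt '' Set.Icc s t) ↔ 𝒞.Runs k s t := by
  cases k with
  | horizontal =>
    simp only [SubchainKind.Holds, Set.forall_mem_image, Subcontinuum.right_eq,
      Subtype.coe_inj]
    exact ⟨fun h => h ⟨le_rfl, hst⟩ ⟨hst, le_rfl⟩, fun h u hu v hv =>
      (hi_eq_of_mem_Icc h hu).trans (hi_eq_of_mem_Icc h hv).symm⟩
  | vertical =>
    simp only [SubchainKind.Holds, Set.forall_mem_image, Subcontinuum.left_eq,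
      Subtype.coe_inj]
    exact ⟨fun h => h ⟨le_rfl, hst⟩ ⟨hst, le_rfl⟩, fun h u hu v hv =>
      (lo_eq_of_mem_Icc h hu).trans (lo_eq_of_mem_Icc h hv).symm⟩
  | strictlyMonotone =>
    simp only [SubchainKind.Holds, Set.forall_mem_image, Subcontinuum.left_eq,
      Subcontinuum.right_eq, Subtype.coe_inj]
    change (∀ ⦃u⦄, u ∈ Set.Icc s t → ∀ ⦃v⦄, v ∈ Set.Icc s t → (𝒞.lo u = 𝒞.lo v ↔ 𝒞.hi u = 𝒞.hi v))
      ↔ _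
    constructor
    · intro h u v hu huv hv
      have h' := h ⟨hu, huv.le.trans hv⟩ ⟨hu.trans huv.le, hv⟩
      exact ⟨fun e => huv.ne (𝒞.eq_of_lo_eq_of_hi_eq e (h'.1 e)),
        fun e => huv.ne (𝒞.eq_of_lo_eq_of_hi_eq (h'.2 e) e)⟩
    · intro h u hu v hv
      rcases lt_trichotomy u v with huv | rfl | huv
      · have := h u v hu.1 huv hv.2
        exact iff_of_false this.1 this.2
      · simp
      · have := h v u hv.1 huv hu.2
        exact iff_of_false this.1.symm this.2.symm

theorem nontrivial_Icc_iff {α : Type*} [PartialOrder α] {a b : α} :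
    (Set.Icc a b).Nontrivial ↔ a < b := by
  constructor
  · rintro ⟨x, hx, y, hy, hne⟩
    refine (hx.1.trans hx.2).lt_of_ne ?_
    rintro rfl
    exact hne ((hx.2.antisymm hx.1).trans (hy.1.antisymm hy.2))
  · exact fun h => ⟨a, Set.left_mem_Icc.2 h.le, b, Set.right_mem_Icc.2 h.le, h.ne⟩

theorem isSubchainOfKind_iff {k : SubchainKind} {ℐ : Set (Subcontinuum unitInterval)} :
    IsSubchainOfKind 𝒞 k ℐ ↔ ∃ a b, a < b ∧ 𝒞.Runs k a b ∧ ℐ = 𝒞.elt '' Set.Icc a b := by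
  constructor
  · intro h
    have hcomp : IsCompact ℐ := 𝒞.isCompact_carrier.of_isClosed_subset h.isClosed h.subset
    have himg : 𝒞.elt '' (Subcontinuum.length '' ℐ) = ℐ := by
      rw [Set.image_image]
      exact (Set.image_congr fun K hK => 𝒞.elt_length (h.subset hK)).trans (Set.image_id' _)
    have hIcc := eq_Icc_of_connected_compact
      (h.isConnected.image _ Subcontinuum.continuous_length.continuousOn)
      (hcomp.image Subcontinuum.continuous_length)
    have hnt : (Subcontinuum.length '' ℐ).Nontrivial :=
      h.nontrivial.image_of_injOn (𝒞.injOn_length.mono h.subset)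
    rw [hIcc] at himg hnt
    have hlt := nontrivial_Icc_iff.1 hnt
    refine ⟨_, _, hlt, ?_, himg.symm⟩
    rw [← holds_image_elt_iff hlt.le, himg]
    exact h.holds
  · rintro ⟨a, b, hab, h, rfl⟩
    refine ⟨?_, (isCompact_Icc.image 𝒞.continuous_elt).isClosed,
      (isConnected_Icc hab.le).image _ 𝒞.continuous_elt.continuousOn,
      (nontrivial_Icc_iff.2 hab).image 𝒞.elt_injective, (holds_image_elt_iff hab.le).2 h⟩
    rw [← range_elt]
    exact Set.image_subset_range _ _

theorem isMaximalSubchain_iff {k : SubchainKind} {ℐ : Set (Subcontinuum unitInterval)} :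
    IsMaximalSubchain 𝒞 k ℐ ↔ ∃ a b, IsMaxInterval 𝒞.Runs k a b ∧ ℐ = 𝒞.elt '' Set.Icc a b := by
  constructor
  · rintro ⟨h, hmax⟩
    obtain ⟨a, b, hab, hr, rfl⟩ := isSubchainOfKind_iff.1 h
    refine ⟨a, b, ⟨hab, hr, fun {a' b'} ha hb hr' => ?_⟩, rfl⟩
    have hlt : a' < b' := ha.trans_lt (hab.trans_le hb)
    have := hmax (isSubchainOfKind_iff.2 ⟨a', b', hlt, hr', rfl⟩)
      (Set.image_mono (Set.Icc_subset_Icc ha hb))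
    rw [Set.image_subset_image_iff 𝒞.elt_injective,
      Set.Icc_subset_Icc_iff hlt.le] at this
    exact ⟨ha.antisymm this.1, this.2.antisymm hb⟩
  · rintro ⟨a, b, h, rfl⟩
    refine ⟨isSubchainOfKind_iff.2 ⟨a, b, h.lt, h.holds, rfl⟩, fun 𝒥 h𝒥 hle => ?_⟩
    obtain ⟨a', b', hab', hr', rfl⟩ := isSubchainOfKind_iff.1 h𝒥
    rw [Set.image_subset_image_iff 𝒞.elt_injective,
      Set.Icc_subset_Icc_iff h.lt.le] at hle
    obtain ⟨rfl, rfl⟩ := h.eq_of_le hle.1 hle.2 hr'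
    exact le_rfl

theorem mem_subchainTops_iff {k : SubchainKind} {A : Subcontinuum unitInterval} :
    A ∈ subchainTops 𝒞 k ↔ ∃ a b, IsMaxInterval 𝒞.Runs k a b ∧ A = 𝒞.elt b := by
  constructor
  · rintro ⟨ℐ, hℐ, hA⟩
    obtain ⟨a, b, h, rfl⟩ := isMaximalSubchain_iff.1 hℐ
    exact ⟨a, b, h, hA.unique (𝒞.strictMono_elt.monotone.map_isGreatest (isGreatest_Icc h.lt.le))⟩
  · rintro ⟨a, b, h, rfl⟩
    exact ⟨_, isMaximalSubchain_iff.2 ⟨a, b, h, rfl⟩,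
      𝒞.strictMono_elt.monotone.map_isGreatest (isGreatest_Icc h.lt.le)⟩

theorem subchainTops_disjoint {k k' : SubchainKind} {A : Subcontinuum unitInterval}
    (h : A ∈ subchainTops 𝒞 k) (h' : A ∈ subchainTops 𝒞 k') : k = k' := by
  obtain ⟨a, b, hm, rfl⟩ := mem_subchainTops_iff.1 h
  obtain ⟨a', b', hm', he⟩ := mem_subchainTops_iff.1 h'
  obtain rfl := 𝒞.elt_injective he
  exact (𝒞.isIntervalSystem_runs.isMaxInterval_eq_of_right_eq hm hm').1

end MaximalChain

/-! ### Changes of the length parameter -/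

/-- The function which is `0` before `a`, `1` after `b`, and affine in between. -/
noncomputable def ramp (a b t : unitInterval) : ℝ := max 0 (min 1 ((t - a : ℝ) / (b - a)))

theorem continuous_ramp (a b : unitInterval) : Continuous (ramp a b) := by
  unfold ramp; fun_prop

theorem ramp_nonneg (a b t : unitInterval) : 0 ≤ ramp a b t := le_max_left _ _

theorem ramp_le_one (a b t : unitInterval) : ramp a b t ≤ 1 :=
  max_le zero_le_one (min_le_left _ _)

theorem ramp_eq_zero {a b t : unitInterval} (hab : a < b) (h : t ≤ a) : ramp a b t = 0 := by
  have h₁ : (a : ℝ) < b := hab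
  have h₂ : (t : ℝ) ≤ a := h
  exact max_eq_left ((min_le_right _ _).trans
    (div_nonpos_of_nonpos_of_nonneg (by linarith) (by linarith)))

theorem ramp_eq_one {a b t : unitInterval} (hab : a < b) (h : b ≤ t) : ramp a b t = 1 := by
  have h₁ : (a : ℝ) < b := hab
  have h₂ : (b : ℝ) ≤ t := h
  have h₃ : (1 : ℝ) ≤ (t - a) / (b - a) := by rw [le_div_iff₀ (by linarith)]; linarith
  rw [ramp, min_eq_left h₃, max_eq_right zero_le_one]

theorem monotone_ramp {a b : unitInterval} (hab : a < b) : Monotone (ramp a b) := by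
  intro s t hst
  have h₁ : (a : ℝ) < b := hab
  have h₂ : (s : ℝ) ≤ t := hst
  have h₃ : (s - a : ℝ) / (b - a) ≤ (t - a) / (b - a) :=
    div_le_div_of_nonneg_right (by linarith) (by linarith)
  exact max_le_max le_rfl (min_le_min le_rfl h₃)

theorem ramp_lt_ramp {a b s t : unitInterval} (hst : s < t) (h : max a s < min b t) :
    ramp a b s < ramp a b t := by
  have h₁ : (a : ℝ) < b := (le_max_left a s).trans_lt (h.trans_le (min_le_left _ _))
  have h₂ : (a : ℝ) < t := (le_max_left a s).trans_lt (h.trans_le (min_le_right _ _))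
  have h₃ : (s : ℝ) < b := (le_max_right a s).trans_lt (h.trans_le (min_le_left _ _))
  have h₄ : (s : ℝ) < t := hst
  have hd : (0 : ℝ) < b - a := by linarith
  have h₅ : (0 : ℝ) < (t - a) / (b - a) := div_pos (by linarith) hd
  have h₆ : (s - a : ℝ) / (b - a) < 1 := by rw [div_lt_one hd]; linarith
  have h₇ : (s - a : ℝ) / (b - a) < (t - a) / (b - a) := div_lt_div_of_pos_right (by linarith) hd
  unfold ramp
  rw [min_eq_right h₆.le]
  exact max_lt (lt_max_of_lt_right (lt_min one_pos h₅)) (lt_max_of_lt_right (lt_min h₆ h₇))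

/-- For non-overlapping intervals with dense union and positive summable weights, a change of scale
of the unit interval which gives each interval its weight as its length. -/
theorem exists_weighted_scale {ι : Type*} {a b : ι → unitInterval} (hab : ∀ i, a i < b i)
    (hb : Function.Injective b) (hsep : ∀ i j, b i < b j → b i ≤ a j)
    (hdense : ∀ s t, s < t → ∃ i, max (a i) s < min (b i) t)
    {w : ι → ℝ} (hw : ∀ i, 0 < w i) (hws : Summable w) :
    ∃ σ : unitInterval → ℝ, Continuous σ ∧ StrictMono σ ∧ σ 0 = 0 ∧ σ 1 = ∑' i, w i ∧
      (∀ j, σ (a j) = ∑' i, w i * ({i | b i < b j} : Set ι).indicator 1 i) ∧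
      ∀ j, σ (b j) = ∑' i, w i * ({i | b i ≤ b j} : Set ι).indicator 1 i := by
  have hle : ∀ i t, w i * ramp (a i) (b i) t ≤ w i := fun i t =>
    mul_le_of_le_one_right (hw i).le (ramp_le_one _ _ _)
  have hnn : ∀ i t, 0 ≤ w i * ramp (a i) (b i) t := fun i t =>
    mul_nonneg (hw i).le (ramp_nonneg _ _ _)
  have hs : ∀ t, Summable fun i => w i * ramp (a i) (b i) t := fun t =>
    hws.of_nonneg_of_le (hnn · t) (hle · t)
  refine ⟨fun t => ∑' i, w i * ramp (a i) (b i) t, ?_, fun s t hst => ?_, ?_, ?_, fun j => ?_,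
    fun j => ?_⟩
  · refine continuous_tsum (fun i => (continuous_ramp _ _).const_mul _) hws fun i t => ?_
    rw [Real.norm_of_nonneg (hnn i t)]
    exact hle i t
  · obtain ⟨i, hi⟩ := hdense s t hst
    exact Summable.tsum_lt_tsum
      (fun i => mul_le_mul_of_nonneg_left (monotone_ramp (hab i) hst.le) (hw i).le)
      (mul_lt_mul_of_pos_left (ramp_lt_ramp hst hi) (hw i)) (hs s) (hs t)
  · simp only [ramp_eq_zero (hab _) unitInterval.nonneg', mul_zero, tsum_zero]
  · simp only [ramp_eq_one (hab _) unitInterval.le_one', mul_one]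
  · refine tsum_congr fun i => congrArg (w i * ·) ?_
    by_cases h : b i < b j
    · rw [ramp_eq_one (hab i) (hsep i j h), Set.indicator_of_mem (by exact h), Pi.one_apply]
    · rw [Set.indicator_of_notMem (by exact h)]
      refine ramp_eq_zero (hab i) ?_
      rcases (not_lt.1 h).lt_or_eq with h' | h'
      · exact (hab j).le.trans (hsep j i h')
      · rw [hb h']
  · refine tsum_congr fun i => congrArg (w i * ·) ?_
    by_cases h : b i ≤ b j
    · rw [ramp_eq_one (hab i) h, Set.indicator_of_mem (by exact h), Pi.one_apply]
    · rw [Set.indicator_of_notMem (by exact h)]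
      exact ramp_eq_zero (hab i) (hsep j i (not_le.1 h))

/-- Two families of non-overlapping intervals with dense unions which are ordered in the same way
correspond under an order automorphism of the unit interval: both are turned into intervals of the
same lengths. -/
theorem exists_orderIso_of_intervals {ι : Type*} [Countable ι] {a b a' b' : ι → unitInterval}
    (hab : ∀ i, a i < b i) (hb : Function.Injective b) (hsep : ∀ i j, b i < b j → b i ≤ a j)
    (hdense : ∀ s t, s < t → ∃ i, max (a i) s < min (b i) t)
    (hab' : ∀ i, a' i < b' i) (hsep' : ∀ i j, b' i < b' j → b' i ≤ a' j)
    (hdense' : ∀ s t, s < t → ∃ i, max (a' i) s < min (b' i) t)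
    (hord : ∀ i j, b i ≤ b j ↔ b' i ≤ b' j) :
    ∃ τ : unitInterval ≃o unitInterval, ∀ i, τ (a i) = a' i ∧ τ (b i) = b' i := by
  have := Encodable.ofCountable ι
  obtain ⟨w, hw, c, hc, -⟩ := posSumOfEncodable one_pos ι
  have hb' : Function.Injective b' := fun i j h =>
    hb (((hord i j).2 h.le).antisymm ((hord j i).2 h.ge))
  have hord' : ∀ i j, b i < b j ↔ b' i < b' j := fun i j => by
    rw [← not_le, ← not_le, hord]
  obtain ⟨σ, hσc, hσ, hσ0, hσ1, hσa, hσb⟩ :=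
    exists_weighted_scale hab hb hsep hdense hw hc.summable
  obtain ⟨σ', hσc', hσ', hσ0', hσ1', hσa', hσb'⟩ :=
    exists_weighted_scale hab' hb' hsep' hdense' hw hc.summable
  have key : ∀ t, ∃ u, σ' u = σ t := fun t =>
    mem_range_of_exists_le_of_exists_ge hσc'
      ⟨0, by rw [hσ0', ← hσ0]; exact hσ.monotone unitInterval.nonneg'⟩
      ⟨1, by rw [hσ1', ← hσ1]; exact hσ.monotone unitInterval.le_one'⟩
  have key' : ∀ u, ∃ t, σ t = σ' u := fun u =>
    mem_range_of_exists_le_of_exists_ge hσc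
      ⟨0, by rw [hσ0, ← hσ0']; exact hσ'.monotone unitInterval.nonneg'⟩
      ⟨1, by rw [hσ1, ← hσ1']; exact hσ'.monotone unitInterval.le_one'⟩
  choose τ hτ using key
  have hmono : StrictMono τ := fun s t h => hσ'.lt_iff_lt.1 (by rw [hτ, hτ]; exact hσ h)
  have hsurj : Function.Surjective τ := fun u => by
    obtain ⟨t, ht⟩ := key' u
    exact ⟨t, hσ'.injective ((hτ t).trans ht)⟩
  refine ⟨hmono.orderIsoOfSurjective τ hsurj, fun i => ⟨hσ'.injective ((hτ _).trans ?_),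
    hσ'.injective ((hτ _).trans ?_)⟩⟩
  · rw [hσa, hσa']; simp only [hord']
  · rw [hσb, hσb']; simp only [hord]

namespace MaximalChain

variable {𝒞 𝒟 : MaximalChain unitInterval}

theorem map_elt {h : unitInterval ≃ₜ unitInterval} (hh : Monotone h)
    {t u : unitInterval} (hlo : h (𝒞.lo t) = 𝒟.lo u) (hhi : h (𝒞.hi t) = 𝒟.hi u) :
    Subcontinuum.map h h.continuous (𝒞.elt t) = 𝒟.elt u :=
  Subcontinuum.ext_lo_hi ((Subcontinuum.lo_map_of_monotone _ hh _).trans hlo)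
    ((Subcontinuum.hi_map_of_monotone _ hh _).trans hhi)

theorem lo_le_lo_iff {s t : unitInterval} :
    𝒞.lo s ≤ 𝒞.lo t ↔ t ≤ s ∨ s < t ∧ 𝒞.Runs .vertical s t := by
  constructor
  · intro h
    exact (le_or_gt t s).imp_right fun h' => ⟨h', h.antisymm (𝒞.antitone_lo h'.le)⟩
  · rintro (h | ⟨-, h⟩)
    · exact 𝒞.antitone_lo h
    · exact h.le

theorem hi_le_hi_iff {s t : unitInterval} :
    𝒞.hi s ≤ 𝒞.hi t ↔ s ≤ t ∨ t < s ∧ 𝒞.Runs .horizontal t s := by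
  constructor
  · intro h
    exact (le_or_gt s t).imp_right fun h' => ⟨h', (𝒞.monotone_hi h'.le).antisymm h⟩
  · rintro (h | ⟨-, h⟩)
    · exact 𝒞.monotone_hi h
    · exact h.ge

/-- A right endpoint lies below a left one only if both agree with the least element of the chain,
a point. -/
theorem hi_le_lo_iff {s t : unitInterval} :
    𝒞.hi s ≤ 𝒞.lo t ↔ 𝒞.hi s ≤ 𝒞.hi 0 ∧ 𝒞.lo 0 ≤ 𝒞.lo t := by
  constructor
  · exact fun h => ⟨h.trans (𝒞.lo_le_hi _ _), (𝒞.lo_le_hi _ _).trans h⟩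
  · exact fun h => h.1.trans (𝒞.lo_zero.ge.trans h.2)

/-- If a change of the length parameter preserves the types of subchains, then the
correspondence of the endpoints is well defined, and it is an increasing homeomorphism. -/
theorem exists_homeomorph_of_timeChange (τ : unitInterval ≃o unitInterval)
    (hτ : ∀ k s t, s < t → (𝒞.Runs k s t ↔ 𝒟.Runs k (τ s) (τ t))) :
    ∃ h : unitInterval ≃ₜ unitInterval, StrictMono h ∧ 𝒟 = h • 𝒞 := by
  have hτ0 : τ 0 = 0 := τ.map_bot
  -- both endpoint functions together, as one map onto the unit interval, which need not be injective
  let γ : unitInterval ⊕ unitInterval → unitInterval := Sum.elim 𝒞.lo 𝒞.hi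
  let γ' : unitInterval ⊕ unitInterval → unitInterval := Sum.elim (𝒟.lo ∘ τ) (𝒟.hi ∘ τ)
  have hlo : ∀ s t, 𝒞.lo s ≤ 𝒞.lo t ↔ 𝒟.lo (τ s) ≤ 𝒟.lo (τ t) := fun s t => by
    rw [lo_le_lo_iff, lo_le_lo_iff, τ.le_iff_le, τ.lt_iff_lt]
    exact or_congr_right (and_congr_right (hτ _ s t))
  have hhi : ∀ s t, 𝒞.hi s ≤ 𝒞.hi t ↔ 𝒟.hi (τ s) ≤ 𝒟.hi (τ t) := fun s t => by
    rw [hi_le_hi_iff, hi_le_hi_iff, τ.le_iff_le, τ.lt_iff_lt]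
    exact or_congr_right (and_congr_right (hτ _ t s))
  have hγ : ∀ x y, γ x ≤ γ y ↔ γ' x ≤ γ' y := by
    rintro (s | s) (t | t)
    · exact hlo s t
    · exact iff_of_true (𝒞.lo_le_hi _ _) (𝒟.lo_le_hi _ _)
    · change 𝒞.hi s ≤ 𝒞.lo t ↔ 𝒟.hi (τ s) ≤ 𝒟.lo (τ t)
      rw [hi_le_lo_iff, hi_le_lo_iff, hhi, hlo, hτ0]
    · exact hhi s t
  have hsurj : ∀ z, ∃ x, γ x = z := fun z => by
    rcases 𝒞.exists_endpoint_eq z with ⟨t, ht⟩ | ⟨t, ht⟩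
    exacts [⟨Sum.inl t, ht⟩, ⟨Sum.inr t, ht⟩]
  have hsurj' : ∀ z, ∃ x, γ' x = z := fun z => by
    rcases 𝒟.exists_endpoint_eq z with ⟨t, ht⟩ | ⟨t, ht⟩
    exacts [⟨Sum.inl (τ.symm t), by simp [γ', ht]⟩, ⟨Sum.inr (τ.symm t), by simp [γ', ht]⟩]
  choose r hr using hsurj
  have hf : ∀ x, γ' (r (γ x)) = γ' x := fun x =>
    ((hγ _ _).1 (hr _).le).antisymm ((hγ _ _).1 (hr _).ge)
  have hmono : StrictMono fun z => γ' (r z) := fun z z' h => by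
    rw [← hr z, ← hr z'] at h
    exact lt_of_not_ge fun h' => h.not_ge ((hγ _ _).2 h')
  have hs : Function.Surjective fun z => γ' (r z) := fun z => by
    obtain ⟨x, rfl⟩ := hsurj' z
    exact ⟨γ x, hf x⟩
  let h := (hmono.orderIsoOfSurjective _ hs).toHomeomorph
  have hcoe : ∀ z, h z = γ' (r z) := fun z => rfl
  have hmap : ∀ t, Subcontinuum.map h h.continuous (𝒞.elt t) = 𝒟.elt (τ t) := fun t =>
    map_elt (h := h) hmono.monotone ((hcoe _).trans (hf (Sum.inl t)))
      ((hcoe _).trans (hf (Sum.inr t)))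
  refine ⟨h, hmono, MaximalChain.ext ?_⟩
  refine Eq.trans ?_ (MaximalChain.carrier_map h 𝒞).symm
  rw [← range_elt, ← range_elt, ← Set.range_comp]
  have : Subcontinuum.map h h.continuous ∘ 𝒞.elt = 𝒟.elt ∘ τ := funext hmap
  rw [this, τ.surjective.range_comp]

/-- The type of all maxima of maximal subchains of `𝒞`. -/
abbrev Tops (𝒞 : MaximalChain unitInterval) : Type :=
  (⋃ k, subchainTops 𝒞 k : Set (Subcontinuum unitInterval))

/-- A correspondence between the maxima of the maximal subchains of two chains which preserves the
types and the inclusion order. -/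
structure TopsEquiv (𝒞 𝒟 : MaximalChain unitInterval) where
  /-- The underlying correspondence. -/
  toEquiv : 𝒞.Tops ≃ 𝒟.Tops
  mem_iff : ∀ (k : SubchainKind) (A : 𝒞.Tops), (A : Subcontinuum unitInterval) ∈ subchainTops 𝒞 k ↔
    (toEquiv A : Subcontinuum unitInterval) ∈ subchainTops 𝒟 k
  le_iff : ∀ A B : 𝒞.Tops, (A : Subcontinuum unitInterval) ≤ B ↔
    (toEquiv A : Subcontinuum unitInterval) ≤ toEquiv B

/-- Chains whose maximal subchains correspond are related by an increasing homeomorphism, because the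
maximal subchains determine the change of the length parameter. -/
theorem TopsEquiv.exists_homeomorph (Ψ : TopsEquiv 𝒞 𝒟)
    (hc : (⋃ k, subchainTops 𝒞 k).Countable) :
    ∃ h : unitInterval ≃ₜ unitInterval, StrictMono h ∧ 𝒟 = h • 𝒞 := by
  have : Countable 𝒞.Tops := hc.to_subtype
  have hC := 𝒞.isIntervalSystem_runs
  have hD := 𝒟.isIntervalSystem_runs
  have key : ∀ A : 𝒞.Tops,
      ∃ k a b a' b', IsMaxInterval 𝒞.Runs k a b ∧ (A : Subcontinuum unitInterval) = 𝒞.elt b ∧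
        IsMaxInterval 𝒟.Runs k a' b' ∧ (Ψ.toEquiv A : Subcontinuum unitInterval) = 𝒟.elt b' := by
    intro A
    obtain ⟨k, hk⟩ := Set.mem_iUnion.1 A.2
    obtain ⟨a, b, h, e⟩ := mem_subchainTops_iff.1 hk
    obtain ⟨a', b', h', e'⟩ := mem_subchainTops_iff.1 ((Ψ.mem_iff k A).1 hk)
    exact ⟨k, a, b, a', b', h, e, h', e'⟩
  choose k a b a' b' hm he hm' he' using key
  -- every maximal interval of either chain occurs in the family
  have hall : ∀ k₀ a₀ b₀, IsMaxInterval 𝒞.Runs k₀ a₀ b₀ → ∃ A, k A = k₀ ∧ a A = a₀ ∧ b A = b₀ := by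
    intro k₀ a₀ b₀ h
    let A : 𝒞.Tops :=
      ⟨𝒞.elt b₀, Set.mem_iUnion.2 ⟨k₀, mem_subchainTops_iff.2 ⟨a₀, b₀, h, rfl⟩⟩⟩
    have hb : b A = b₀ := 𝒞.elt_injective (he A).symm
    have h' := hm A
    rw [hb] at h'
    obtain ⟨h₁, h₂⟩ := hC.isMaxInterval_eq_of_right_eq h' h
    exact ⟨A, h₁, h₂, hb⟩
  have hall' : ∀ k₀ a₀ b₀, IsMaxInterval 𝒟.Runs k₀ a₀ b₀ →
      ∃ A, k A = k₀ ∧ a' A = a₀ ∧ b' A = b₀ := by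
    intro k₀ a₀ b₀ h
    let B : 𝒟.Tops :=
      ⟨𝒟.elt b₀, Set.mem_iUnion.2 ⟨k₀, mem_subchainTops_iff.2 ⟨a₀, b₀, h, rfl⟩⟩⟩
    have hb : b' (Ψ.toEquiv.symm B) = b₀ := 𝒟.elt_injective (by
      rw [← he', Equiv.apply_symm_apply])
    have h' := hm' (Ψ.toEquiv.symm B)
    rw [hb] at h'
    obtain ⟨h₁, h₂⟩ := hD.isMaxInterval_eq_of_right_eq h' h
    exact ⟨_, h₁, h₂, hb⟩
  obtain ⟨τ, hτ⟩ := exists_orderIso_of_intervals (a := a) (b := b) (a' := a') (b' := b')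
    (fun A => (hm A).lt)
    (fun A B h => Subtype.ext (by rw [he, he, h]))
    (fun A B h => hC.right_le_left_of_lt (hm A) (hm B) h)
    (fun s t hst => by
      obtain ⟨k₀, a₀, b₀, h, h'⟩ := hC.exists_isMaxInterval_inter hst
      obtain ⟨A, -, rfl, rfl⟩ := hall _ _ _ h
      exact ⟨A, h'⟩)
    (fun A => (hm' A).lt)
    (fun A B h => hD.right_le_left_of_lt (hm' A) (hm' B) h)
    (fun s t hst => by
      obtain ⟨k₀, a₀, b₀, h, h'⟩ := hD.exists_isMaxInterval_inter hst
      obtain ⟨A, -, rfl, rfl⟩ := hall' _ _ _ h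
      exact ⟨A, h'⟩)
    (fun A B => by
      rw [← 𝒞.strictMono_elt.le_iff_le, ← 𝒟.strictMono_elt.le_iff_le, ← he, ← he, ← he', ← he']
      exact Ψ.le_iff A B)
  refine exists_homeomorph_of_timeChange τ fun k₀ s t hst => ?_
  rw [hC.iff_exists_isMaxInterval hst, hD.iff_exists_isMaxInterval (τ.lt_iff_lt.2 hst)]
  constructor
  · rintro ⟨a₀, b₀, ha, hb, h⟩
    obtain ⟨A, rfl, rfl, rfl⟩ := hall _ _ _ h
    refine ⟨a' A, b' A, ?_, ?_, hm' A⟩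
    · rw [← (hτ A).1]; exact τ.monotone ha
    · rw [← (hτ A).2]; exact τ.monotone hb
  · rintro ⟨a₀, b₀, ha, hb, h⟩
    obtain ⟨A, rfl, rfl, rfl⟩ := hall' _ _ _ h
    rw [← (hτ A).1, τ.le_iff_le] at ha
    rw [← (hτ A).2, τ.le_iff_le] at hb
    exact ⟨a A, b A, ha, hb, hm A⟩

end MaximalChain

/-! ### Transport of subchains by homeomorphisms -/

/-- The homeomorphism of the hyperspace of subcontinua induced by a homeomorphism. -/
def Subcontinuum.mapHomeomorph {X : Type*} [TopologicalSpace X] (h : X ≃ₜ X) :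
    Subcontinuum X ≃ₜ Subcontinuum X where
  toEquiv := (Subcontinuum.mapRelIso h).toEquiv
  continuous_toFun := Subcontinuum.continuous_map h h.continuous
  continuous_invFun := Subcontinuum.continuous_map h.symm h.symm.continuous

theorem Subcontinuum.mapHomeomorph_le_iff {X : Type*} [TopologicalSpace X] (h : X ≃ₜ X)
    {K L : Subcontinuum X} :
    Subcontinuum.mapHomeomorph h K ≤ Subcontinuum.mapHomeomorph h L ↔ K ≤ L :=
  (Subcontinuum.mapRelIso h).map_rel_iff

theorem MaximalChain.carrier_smul {X : Type*} [TopologicalSpace X] (h : X ≃ₜ X)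
    (𝒞 : MaximalChain X) :
    (h • 𝒞).carrier = Subcontinuum.mapHomeomorph h '' 𝒞.carrier :=
  MaximalChain.carrier_map h 𝒞

/-- The homeomorphism `h` turns subchains of each type `k` into subchains of type `ρ k`. -/
def PermutesKinds (h : unitInterval ≃ₜ unitInterval) (ρ : SubchainKind → SubchainKind) : Prop :=
  ∀ (k : SubchainKind) (ℐ : Set (Subcontinuum unitInterval)),
    (ρ k).Holds (Subcontinuum.mapHomeomorph h '' ℐ) ↔ k.Holds ℐ

section Transport

variable {h : unitInterval ≃ₜ unitInterval} {ρ : SubchainKind → SubchainKind}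
  {𝒞 : MaximalChain unitInterval} {k : SubchainKind}

theorem PermutesKinds.isSubchainOfKind_iff (hρ : PermutesKinds h ρ)
    {ℐ : Set (Subcontinuum unitInterval)} :
    IsSubchainOfKind (h • 𝒞) (ρ k) (Subcontinuum.mapHomeomorph h '' ℐ) ↔
      IsSubchainOfKind 𝒞 k ℐ := by
  have hf := (Subcontinuum.mapHomeomorph h).injective
  constructor
  · rintro ⟨h₁, h₂, h₃, h₄, h₅⟩
    rw [MaximalChain.carrier_smul, Set.image_subset_image_iff hf] at h₁
    exact ⟨h₁, (Subcontinuum.mapHomeomorph h).isClosed_image.1 h₂,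
      (Subcontinuum.mapHomeomorph h).isConnected_image.1 h₃, Set.nontrivial_of_image _ _ h₄,
      (hρ _ _).1 h₅⟩
  · rintro ⟨h₁, h₂, h₃, h₄, h₅⟩
    refine ⟨?_, (Subcontinuum.mapHomeomorph h).isClosed_image.2 h₂,
      (Subcontinuum.mapHomeomorph h).isConnected_image.2 h₃, h₄.image hf, (hρ _ _).2 h₅⟩
    rwa [MaximalChain.carrier_smul, Set.image_subset_image_iff hf]

theorem PermutesKinds.isMaximalSubchain_iff (hρ : PermutesKinds h ρ)
    {ℐ : Set (Subcontinuum unitInterval)} :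
    IsMaximalSubchain (h • 𝒞) (ρ k) (Subcontinuum.mapHomeomorph h '' ℐ) ↔
      IsMaximalSubchain 𝒞 k ℐ := by
  refine and_congr hρ.isSubchainOfKind_iff ⟨fun H 𝒥 h𝒥 hle => ?_, fun H 𝒥 h𝒥 hle => ?_⟩
  · have := H (hρ.isSubchainOfKind_iff.2 h𝒥) (Set.image_mono hle)
    exact (Set.image_subset_image_iff (Subcontinuum.mapHomeomorph h).injective).1 this
  · obtain ⟨𝒥', rfl⟩ := (Subcontinuum.mapHomeomorph h).surjective.image_surjective 𝒥
    exact Set.image_mono (H (hρ.isSubchainOfKind_iff.1 h𝒥)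
      ((Set.image_subset_image_iff (Subcontinuum.mapHomeomorph h).injective).1 hle))

theorem PermutesKinds.mem_subchainTops_iff (hρ : PermutesKinds h ρ)
    {A : Subcontinuum unitInterval} :
    Subcontinuum.mapHomeomorph h A ∈ subchainTops (h • 𝒞) (ρ k) ↔ A ∈ subchainTops 𝒞 k := by
  have hgr : ∀ ℐ : Set (Subcontinuum unitInterval),
      IsGreatest (Subcontinuum.mapHomeomorph h '' ℐ) (Subcontinuum.mapHomeomorph h A) ↔
        IsGreatest ℐ A := fun ℐ =>
    and_congr (Subcontinuum.mapHomeomorph h).injective.mem_set_image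
      (Set.forall_mem_image.trans
        (forall₂_congr fun _ _ => Subcontinuum.mapHomeomorph_le_iff h))
  constructor
  · rintro ⟨𝒥, h𝒥, hA⟩
    obtain ⟨ℐ, rfl⟩ := (Subcontinuum.mapHomeomorph h).surjective.image_surjective 𝒥
    exact ⟨ℐ, hρ.isMaximalSubchain_iff.1 h𝒥, (hgr ℐ).1 hA⟩
  · rintro ⟨ℐ, hℐ, hA⟩
    exact ⟨_, hρ.isMaximalSubchain_iff.2 hℐ, (hgr ℐ).2 hA⟩

theorem PermutesKinds.iUnion_subchainTops (hρ : PermutesKinds h ρ)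
    (hs : Function.Surjective ρ) :
    ⋃ k, subchainTops (h • 𝒞) k = Subcontinuum.mapHomeomorph h '' ⋃ k, subchainTops 𝒞 k := by
  ext B
  obtain ⟨A, rfl⟩ := (Subcontinuum.mapHomeomorph h).surjective B
  rw [(Subcontinuum.mapHomeomorph h).injective.mem_set_image, Set.mem_iUnion, Set.mem_iUnion,
    hs.exists]
  exact exists_congr fun k => hρ.mem_subchainTops_iff

theorem permutesKinds_of_monotone (hm : Monotone h) : PermutesKinds h id := by
  have hl : ∀ K, (Subcontinuum.mapHomeomorph h K).lo = h K.lo :=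
    Subcontinuum.lo_map_of_monotone h.continuous hm
  have hr : ∀ K, (Subcontinuum.mapHomeomorph h K).hi = h K.hi :=
    Subcontinuum.hi_map_of_monotone h.continuous hm
  intro k ℐ
  cases k <;> simp only [id, SubchainKind.Holds, Set.forall_mem_image, Subcontinuum.left_eq,
    Subcontinuum.right_eq, Subtype.coe_inj, hl, hr, h.injective.eq_iff]

/-- The exchange of the horizontal and the vertical type. -/
def SubchainKind.swap : SubchainKind → SubchainKind
  | .horizontal => .vertical
  | .vertical => .horizontal
  | .strictlyMonotone => .strictlyMonotone

theorem SubchainKind.swap_swap (k : SubchainKind) : k.swap.swap = k := by cases k <;> rfl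

theorem permutesKinds_of_antitone (hm : Antitone h) : PermutesKinds h SubchainKind.swap := by
  have hl : ∀ K, (Subcontinuum.mapHomeomorph h K).lo = h K.hi :=
    Subcontinuum.lo_map_of_antitone h.continuous hm
  have hr : ∀ K, (Subcontinuum.mapHomeomorph h K).hi = h K.lo :=
    Subcontinuum.hi_map_of_antitone h.continuous hm
  intro k ℐ
  cases k <;> simp only [SubchainKind.swap, SubchainKind.Holds, Set.forall_mem_image,
    Subcontinuum.left_eq, Subcontinuum.right_eq, Subtype.coe_inj, hl, hr, h.injective.eq_iff]
  exact forall₂_congr fun _ _ => forall₂_congr fun _ _ => Iff.comm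

theorem MaximalChain.nonempty_topsEquiv_smul (hm : Monotone h) :
    Nonempty (MaximalChain.TopsEquiv 𝒞 (h • 𝒞)) := by
  have hρ := permutesKinds_of_monotone hm
  exact ⟨⟨((Subcontinuum.mapHomeomorph h).toEquiv.image _).trans
      (Equiv.setCongr (hρ.iUnion_subchainTops Function.surjective_id).symm),
    fun k A => (hρ.mem_subchainTops_iff (k := k)).symm,
    fun A B => (Subcontinuum.mapHomeomorph_le_iff h).symm⟩⟩

end Transport

/-! ### Isomorphism of the structures of subchains -/

theorem CodedStructure.isomorphic_iff {L : FirstOrder.Language.{0, 0}} [L.IsRelational]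
    {M N : CodedStructure L} :
    M.Isomorphic N ↔ ∃ φ : ℕ ≃ ℕ, ∀ R v, M R v = true ↔ N R (φ ∘ v) = true := by
  constructor
  · rintro ⟨e⟩
    exact ⟨@FirstOrder.Language.Equiv.toEquiv L ℕ ℕ M.toStructure N.toStructure e, fun R v =>
      (@FirstOrder.Language.Equiv.map_rel' L ℕ ℕ M.toStructure N.toStructure e R.1 R.2 v).symm⟩
  · rintro ⟨φ, hφ⟩
    exact ⟨@FirstOrder.Language.Equiv.mk L ℕ ℕ M.toStructure N.toStructure φ
      (fun f => isEmptyElim f) (fun R v => (hφ ⟨_, R⟩ v).symm)⟩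

/-- An isomorphism of structures for the language of subchains, spelled out. -/
structure IsSubchainIso (M M' : CodedStructure subchainLanguage) (φ : ℕ ≃ ℕ) : Prop where
  kind : ∀ k n, M ⟨1, SubchainRelation.kind k⟩ ![n] = true ↔
    M' ⟨1, SubchainRelation.kind k⟩ ![φ n] = true
  below : ∀ n m, M ⟨2, SubchainRelation.below⟩ ![n, m] = true ↔
    M' ⟨2, SubchainRelation.below⟩ ![φ n, φ m] = true

theorem isomorphic_iff_exists_isSubchainIso {M M' : CodedStructure subchainLanguage} :
    M.Isomorphic M' ↔ ∃ φ, IsSubchainIso M M' φ := by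
  rw [CodedStructure.isomorphic_iff]
  refine exists_congr fun φ => ⟨fun h => ⟨fun k n => ?_, fun n m => ?_⟩, fun h => ?_⟩
  · rw [h, show φ ∘ ![n] = ![φ n] by ext i; fin_cases i; rfl]
  · rw [h, show φ ∘ ![n, m] = ![φ n, φ m] by ext i; fin_cases i <;> rfl]
  · rintro ⟨_, R⟩ v
    cases R with
    | kind k =>
      have hv : v = ![v 0] := by ext i; fin_cases i; rfl
      have hφv : φ ∘ v = ![φ (v 0)] := by ext i; fin_cases i; rfl
      rw [hφv, hv]
      exact h.kind k _
    | below =>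
      have hv : v = ![v 0, v 1] := by ext i; fin_cases i <;> rfl
      have hφv : φ ∘ v = ![φ (v 0), φ (v 1)] := by ext i; fin_cases i <;> rfl
      rw [hφv, hv]
      exact h.below _ _

/-- A bijection between sets of indices extends to all indices if each of the two sets is either
finite or contains all indices. -/
theorem exists_equiv_extending {N N' : Set ℕ} (hN : N.Infinite → N = Set.univ)
    (hN' : N'.Infinite → N' = Set.univ) (ψ : N ≃ N') :
    ∃ φ : ℕ ≃ ℕ, (∀ n : N, φ n = ψ n) ∧ ∀ n, n ∈ N ↔ φ n ∈ N' := by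
  classical
  have hχ : Nonempty ((Nᶜ : Set ℕ) ≃ (N'ᶜ : Set ℕ)) := by
    by_cases hfin : N.Finite
    · have := hfin.to_subtype
      have hfin' : N'.Finite := Set.finite_coe_iff.1 (Finite.of_equiv N ψ)
      have : Infinite (Nᶜ : Set ℕ) := hfin.infinite_compl.to_subtype
      have : Infinite (N'ᶜ : Set ℕ) := hfin'.infinite_compl.to_subtype
      exact nonempty_equiv_of_countable
    · have hfin' : ¬ N'.Finite := fun h => by
        have := h.to_subtype
        exact hfin (Set.finite_coe_iff.1 (Finite.of_equiv N' ψ.symm))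
      rw [hN hfin, hN' hfin']
      exact ⟨Equiv.refl _⟩
  obtain ⟨χ⟩ := hχ
  have h₁ : ∀ n (hn : n ∈ N), ((Equiv.Set.sumCompl N).symm.trans
      ((Equiv.sumCongr ψ χ).trans (Equiv.Set.sumCompl N'))) n = ψ ⟨n, hn⟩ := fun n hn => by
    simp [Equiv.Set.sumCompl_symm_apply_of_mem hn]
  have h₂ : ∀ n (hn : n ∉ N), ((Equiv.Set.sumCompl N).symm.trans
      ((Equiv.sumCongr ψ χ).trans (Equiv.Set.sumCompl N'))) n = χ ⟨n, hn⟩ := fun n hn => by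
    simp [Equiv.Set.sumCompl_symm_apply_of_notMem hn]
  refine ⟨_, fun n => h₁ n n.2, fun n => ?_⟩
  by_cases hn : n ∈ N
  · rw [h₁ n hn]; exact iff_of_true hn (ψ _).2
  · rw [h₂ n hn]; exact iff_of_false hn (χ _).2

/-- Isomorphisms correspond to bijections of the recorded maxima, as the indices which are not used
are either none or infinitely many on both sides. -/
theorem RecordsSubchains.isomorphic_iff {M M' : CodedStructure subchainLanguage}
    {𝒞 𝒟 : MaximalChain unitInterval} (hM : RecordsSubchains M 𝒞) (hM' : RecordsSubchains M' 𝒟) :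
    M.Isomorphic M' ↔ Nonempty (MaximalChain.TopsEquiv 𝒞 𝒟) := by
  rw [isomorphic_iff_exists_isSubchainIso]
  obtain ⟨N, e, he, hN, hk, hb⟩ := hM
  obtain ⟨N', e', he', hN', hk', hb'⟩ := hM'
  let E : N ≃ 𝒞.Tops := he.equiv e
  let E' : N' ≃ 𝒟.Tops := he'.equiv e'
  have hE : ∀ n, (E n : Subcontinuum unitInterval) = e n := fun n => rfl
  have hE' : ∀ n, (E' n : Subcontinuum unitInterval) = e' n := fun n => rfl
  constructor
  · rintro ⟨φ, hφ⟩
    have hφN : ∀ n, n ∈ N ↔ φ n ∈ N' := fun n => by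
      have := hφ.below n n
      rw [hb, hb'] at this
      simpa using this
    refine ⟨⟨E.symm.trans ((φ.subtypeEquiv hφN).trans E'), fun k A => ?_, fun A B => ?_⟩⟩
    · obtain ⟨n, rfl⟩ := E.surjective A
      have := hφ.kind k n
      rw [hk, hk', and_iff_right n.2, and_iff_right ((hφN n).1 n.2)] at this
      simpa [hE, hE'] using this
    · obtain ⟨n, rfl⟩ := E.surjective A
      obtain ⟨m, rfl⟩ := E.surjective B
      have := hφ.below n m
      rw [hb, hb', and_iff_right n.2, and_iff_right m.2, and_iff_right ((hφN n).1 n.2),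
        and_iff_right ((hφN m).1 m.2)] at this
      simpa only [Equiv.trans_apply, Equiv.symm_apply_apply, hE, hE',
        Equiv.subtypeEquiv_apply] using this
  · rintro ⟨Ψ⟩
    obtain ⟨φ, hφ, hφN⟩ := exists_equiv_extending hN hN' (E.trans (Ψ.toEquiv.trans E'.symm))
    have hφe : ∀ n : N, (Ψ.toEquiv (E n) : Subcontinuum unitInterval) = e' (φ n) := fun n => by
      rw [hφ, ← hE']; simp
    refine ⟨φ, fun k n => ?_, fun n m => ?_⟩
    · rw [hk, hk', ← hφN]
      refine and_congr_right fun hn => ?_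
      rw [← hφe ⟨n, hn⟩]
      exact Ψ.mem_iff k (E ⟨n, hn⟩)
    · rw [hb, hb', ← hφN, ← hφN]
      refine and_congr_right fun hn => and_congr_right fun hm => ?_
      rw [← hφe ⟨n, hn⟩, ← hφe ⟨m, hm⟩]
      exact Ψ.le_iff (E ⟨n, hn⟩) (E ⟨m, hm⟩)

theorem RecordsSubchains.countable_tops {M : CodedStructure subchainLanguage}
    {𝒞 : MaximalChain unitInterval} (hM : RecordsSubchains M 𝒞) :
    (⋃ k, subchainTops 𝒞 k).Countable := by
  obtain ⟨N, e, he, -⟩ := hM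
  rw [← he.image_eq]
  exact N.to_countable.image e

/-- The structure of maximal subchains is a complete invariant of a chain for increasing
homeomorphisms. -/
theorem RecordsSubchains.exists_strictMono_iff {M M' : CodedStructure subchainLanguage}
    {𝒞 𝒟 : MaximalChain unitInterval} (hM : RecordsSubchains M 𝒞) (hM' : RecordsSubchains M' 𝒟) :
    (∃ h : unitInterval ≃ₜ unitInterval, StrictMono h ∧ 𝒟 = h • 𝒞) ↔ M.Isomorphic M' := by
  rw [hM.isomorphic_iff hM']
  constructor
  · rintro ⟨h, hm, rfl⟩
    exact MaximalChain.nonempty_topsEquiv_smul hm.monotone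
  · rintro ⟨Ψ⟩
    exact Ψ.exists_homeomorph hM.countable_tops

/-! ### Forgetting the orientation -/

/-- The structure in which the horizontal and the vertical type are exchanged. -/
def CodedStructure.swap (M : CodedStructure subchainLanguage) : CodedStructure subchainLanguage
  | ⟨_, SubchainRelation.kind k⟩, v => M ⟨1, SubchainRelation.kind k.swap⟩ v
  | ⟨_, SubchainRelation.below⟩, v => M ⟨2, SubchainRelation.below⟩ v

theorem RecordsSubchains.swap {M : CodedStructure subchainLanguage}
    {𝒞 : MaximalChain unitInterval} (hM : RecordsSubchains M 𝒞)
    {h : unitInterval ≃ₜ unitInterval} (hm : Antitone h) :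
    RecordsSubchains M.swap (h • 𝒞) := by
  obtain ⟨N, e, he, hN, hk, hb⟩ := hM
  have hρ := permutesKinds_of_antitone hm
  refine ⟨N, Subcontinuum.mapHomeomorph h ∘ e, ?_, hN, fun k n => ?_, fun n m => ?_⟩
  · rw [hρ.iUnion_subchainTops fun k => ⟨k.swap, k.swap_swap⟩]
    exact ((Subcontinuum.mapHomeomorph h).injective.injOn.bijOn_image).comp he
  · refine (hk k.swap n).trans (and_congr_right fun _ => ?_)
    have := hρ.mem_subchainTops_iff (𝒞 := 𝒞) (k := k.swap) (A := e n)
    rw [k.swap_swap] at this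
    exact this.symm
  · exact (hb n m).trans (and_congr_right fun _ => and_congr_right fun _ =>
      (Subcontinuum.mapHomeomorph_le_iff h).symm)

/-- The relation symbols of the language of unoriented subchains: a binary relation which holds if
both subchains are horizontal or both are vertical, and a binary relation for the order. -/
inductive UnorientedRelation : ℕ → Type
  | sameKind : UnorientedRelation 2
  | below : UnorientedRelation 2

/-- The relational language of unoriented subchains. -/
def unorientedLanguage : FirstOrder.Language.{0, 0} where
  Functions _ := Empty
  Relations := UnorientedRelation

instance unorientedLanguage.instIsRelational : unorientedLanguage.IsRelational :=
  fun _ => Empty.instIsEmpty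

/-- The reduct of a structure of subchains which forgets which of the two types is the horizontal
one. -/
def CodedStructure.unorient (M : CodedStructure subchainLanguage) :
    CodedStructure unorientedLanguage
  | ⟨_, UnorientedRelation.sameKind⟩, v =>
    (M ⟨1, SubchainRelation.kind .horizontal⟩ ![v 0] &&
      M ⟨1, SubchainRelation.kind .horizontal⟩ ![v 1]) ||
    (M ⟨1, SubchainRelation.kind .vertical⟩ ![v 0] &&
      M ⟨1, SubchainRelation.kind .vertical⟩ ![v 1])
  | ⟨_, UnorientedRelation.below⟩, v => M ⟨2, SubchainRelation.below⟩ ![v 0, v 1]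

theorem isomorphic_unorient_iff {M M' : CodedStructure subchainLanguage} :
    M.unorient.Isomorphic M'.unorient ↔ ∃ φ : ℕ ≃ ℕ,
      (∀ n m, M.unorient ⟨2, UnorientedRelation.sameKind⟩ ![n, m] = true ↔
        M'.unorient ⟨2, UnorientedRelation.sameKind⟩ ![φ n, φ m] = true) ∧
      ∀ n m, M ⟨2, SubchainRelation.below⟩ ![n, m] = true ↔
        M' ⟨2, SubchainRelation.below⟩ ![φ n, φ m] = true := by
  rw [CodedStructure.isomorphic_iff]
  refine exists_congr fun φ => ⟨fun h => ⟨fun n m => ?_, fun n m => ?_⟩, fun h => ?_⟩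
  · exact h ⟨2, UnorientedRelation.sameKind⟩ ![n, m]
  · exact h ⟨2, UnorientedRelation.below⟩ ![n, m]
  · rintro ⟨_, R⟩ v
    cases R with
    | sameKind => exact h.1 (v 0) (v 1)
    | below => exact h.2 (v 0) (v 1)

/-- A bijection which preserves the unordered pair of sets `{H, V}`, in the sense that it preserves
the relation of being in the same one of them, preserves or exchanges the two sets. -/
theorem preserves_or_exchanges {H V H' V' : ℕ → Prop} {φ : ℕ → ℕ}
    (hd : ∀ n, ¬ (H n ∧ V n)) (hd' : ∀ n, ¬ (H' n ∧ V' n))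
    (h : ∀ n m, (H n ∧ H m) ∨ (V n ∧ V m) ↔
      (H' (φ n) ∧ H' (φ m)) ∨ (V' (φ n) ∧ V' (φ m))) :
    (∀ n, (H n ↔ H' (φ n)) ∧ (V n ↔ V' (φ n))) ∨ ∀ n, (H n ↔ V' (φ n)) ∧ (V n ↔ H' (φ n)) := by
  by_cases hex : ∃ m, (H m ∧ H' (φ m)) ∨ (V m ∧ V' (φ m))
  · obtain ⟨m, hm⟩ := hex
    refine Or.inl fun n => ?_
    have h₁ := h n m
    have h₂ := h n n
    have h₃ := hd n
    have h₄ := hd m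
    have h₅ := hd' (φ n)
    have h₆ := hd' (φ m)
    grind
  · refine Or.inr fun n => ?_
    have h₁ := h n n
    have h₂ := fun h' => hex ⟨n, h'⟩
    have h₃ := hd n
    have h₅ := hd' (φ n)
    grind

theorem RecordsSubchains.below_self_iff {M : CodedStructure subchainLanguage}
    {𝒞 : MaximalChain unitInterval} (hM : RecordsSubchains M 𝒞) (n : ℕ) :
    M ⟨2, SubchainRelation.below⟩ ![n, n] = true ↔
      ∃ k, M ⟨1, SubchainRelation.kind k⟩ ![n] = true := by
  obtain ⟨N, e, he, -, hk, hb⟩ := hM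
  simp only [hk, hb]
  refine ⟨fun h => ?_, fun ⟨k, h⟩ => ⟨h.1, h.1, le_rfl⟩⟩
  obtain ⟨k, hk⟩ := Set.mem_iUnion.1 (he.mapsTo h.1)
  exact ⟨k, h.1, hk⟩

theorem RecordsSubchains.kind_unique {M : CodedStructure subchainLanguage}
    {𝒞 : MaximalChain unitInterval} (hM : RecordsSubchains M 𝒞) {n : ℕ} {k k' : SubchainKind}
    (h : M ⟨1, SubchainRelation.kind k⟩ ![n] = true)
    (h' : M ⟨1, SubchainRelation.kind k'⟩ ![n] = true) : k = k' := by
  obtain ⟨N, e, he, -, hk, hb⟩ := hM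
  rw [hk] at h h'
  exact MaximalChain.subchainTops_disjoint h.2 h'.2

/-- The strictly monotone subchains are the recorded ones of neither of the other two types, so the
unoriented structure determines them. -/
theorem RecordsSubchains.strictlyMonotone_iff {M : CodedStructure subchainLanguage}
    {𝒞 : MaximalChain unitInterval} (hM : RecordsSubchains M 𝒞) (n : ℕ) :
    M ⟨1, SubchainRelation.kind .strictlyMonotone⟩ ![n] = true ↔
      M ⟨2, SubchainRelation.below⟩ ![n, n] = true ∧
        ¬ M ⟨1, SubchainRelation.kind .horizontal⟩ ![n] = true ∧
        ¬ M ⟨1, SubchainRelation.kind .vertical⟩ ![n] = true := by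
  rw [hM.below_self_iff]
  constructor
  · intro h
    refine ⟨⟨_, h⟩, fun h' => ?_, fun h' => ?_⟩ <;> cases hM.kind_unique h h'
  · rintro ⟨⟨k, hk⟩, hh, hv⟩
    cases k with
    | horizontal => exact (hh hk).elim
    | vertical => exact (hv hk).elim
    | strictlyMonotone => exact hk

theorem RecordsSubchains.isomorphic_unorient_iff {M M' : CodedStructure subchainLanguage}
    {𝒞 𝒟 : MaximalChain unitInterval} (hM : RecordsSubchains M 𝒞) (hM' : RecordsSubchains M' 𝒟) :
    M.unorient.Isomorphic M'.unorient ↔ M.Isomorphic M' ∨ M.swap.Isomorphic M' := by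
  rw [_root_.isomorphic_unorient_iff, isomorphic_iff_exists_isSubchainIso,
    isomorphic_iff_exists_isSubchainIso, ← exists_or]
  refine exists_congr fun φ => ?_
  simp only [CodedStructure.unorient, Bool.or_eq_true, Bool.and_eq_true]
  constructor
  · rintro ⟨hs, hb⟩
    have hS := fun n => hM.strictlyMonotone_iff n
    have hS' := fun n => hM'.strictlyMonotone_iff n
    rcases preserves_or_exchanges (φ := φ)
        (H := fun n => M ⟨1, SubchainRelation.kind .horizontal⟩ ![n] = true)
        (V := fun n => M ⟨1, SubchainRelation.kind .vertical⟩ ![n] = true)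
        (H' := fun n => M' ⟨1, SubchainRelation.kind .horizontal⟩ ![n] = true)
        (V' := fun n => M' ⟨1, SubchainRelation.kind .vertical⟩ ![n] = true)
        (fun n h => by cases hM.kind_unique h.1 h.2) (fun n h => by cases hM'.kind_unique h.1 h.2)
        hs with h | h
    · refine Or.inl ⟨fun k n => ?_, hb⟩
      cases k with
      | horizontal => exact (h n).1
      | vertical => exact (h n).2
      | strictlyMonotone => rw [hS, hS', hb, (h n).1, (h n).2]
    · refine Or.inr ⟨fun k n => ?_, hb⟩
      cases k with
      | horizontal => exact (h n).2
      | vertical => exact (h n).1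
      | strictlyMonotone =>
        refine (hS n).trans ?_
        rw [hS', hb, (h n).1, (h n).2, and_comm (a := ¬ _ = true)]
  · rintro (h | h)
    · refine ⟨fun n m => ?_, h.below⟩
      exact or_congr (and_congr (h.kind _ _) (h.kind _ _)) (and_congr (h.kind _ _) (h.kind _ _))
    · refine ⟨fun n m => or_comm.trans ?_, h.below⟩
      exact or_congr (and_congr (h.kind .horizontal n) (h.kind .horizontal m))
        (and_congr (h.kind .vertical n) (h.kind .vertical m))

/-- The unoriented structure of maximal subchains is a complete invariant of a chain for all
homeomorphisms: a decreasing one is an increasing one composed with the reflection. -/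
theorem RecordsSubchains.exists_homeomorph_iff {M M' : CodedStructure subchainLanguage}
    {𝒞 𝒟 : MaximalChain unitInterval} (hM : RecordsSubchains M 𝒞) (hM' : RecordsSubchains M' 𝒟) :
    (∃ h : unitInterval ≃ₜ unitInterval, 𝒟 = h • 𝒞) ↔
      M.unorient.Isomorphic M'.unorient := by
  let r := unitInterval.symmHomeomorph
  have hr : StrictAnti r := unitInterval.strictAnti_symm
  rw [hM.isomorphic_unorient_iff hM', ← hM.exists_strictMono_iff hM',
    ← (hM.swap hr.antitone).exists_strictMono_iff hM']
  constructor
  · rintro ⟨h, rfl⟩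
    rcases h.continuous.strictMono_of_inj_boundedOrder' h.injective with hm | hm
    · exact Or.inl ⟨h, hm, rfl⟩
    · refine Or.inr ⟨h * r⁻¹, hm.comp ?_, by rw [smul_smul, inv_mul_cancel_right]⟩
      exact unitInterval.strictAnti_symm
  · rintro (⟨h, -, e⟩ | ⟨h, -, e⟩)
    · exact ⟨h, e⟩
    · exact ⟨h * r, by rw [e, smul_smul]⟩

/-! ### A structure of subchains for every chain -/

namespace MaximalChain

variable (𝒞 : MaximalChain unitInterval)

/-- `i` is the first index of a point of the dense sequence inside some maximal interval of type
`k`. Such indices stand for the maximal subchains. -/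
def IsFirstIndex (k : SubchainKind) (i : ℕ) : Prop :=
  ∃ a b, IsMaxInterval 𝒞.Runs k a b ∧ denseSeq unitInterval i ∈ Set.Ioo a b ∧
    ∀ j < i, denseSeq unitInterval j ∉ Set.Ioo a b

open Classical in
/-- The number of first indices below `i`. -/
noncomputable def position (i : ℕ) : ℕ := Nat.count (fun j => ∃ k, 𝒞.IsFirstIndex k j) i

open Classical in
/-- The structure of the maximal subchains of `𝒞`, which are enumerated in the order of their first
indices. -/
noncomputable def subchainStructure : CodedStructure subchainLanguage
  | ⟨_, SubchainRelation.kind k⟩, v => decide (∃ i, 𝒞.IsFirstIndex k i ∧ 𝒞.position i = v 0)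
  | ⟨_, SubchainRelation.below⟩, v => decide (∃ i j, (∃ k, 𝒞.IsFirstIndex k i) ∧
      (∃ k, 𝒞.IsFirstIndex k j) ∧ denseSeq unitInterval i ≤ denseSeq unitInterval j ∧
      𝒞.position i = v 0 ∧ 𝒞.position j = v 1)

variable {𝒞}

theorem exists_isFirstIndex {k : SubchainKind} {a b : unitInterval}
    (h : IsMaxInterval 𝒞.Runs k a b) :
    ∃ i, denseSeq unitInterval i ∈ Set.Ioo a b ∧ ∀ j < i, denseSeq unitInterval j ∉ Set.Ioo a b := by
  classical
  have hex : ∃ i, denseSeq unitInterval i ∈ Set.Ioo a b :=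
    (denseRange_denseSeq unitInterval).exists_mem_open isOpen_Ioo (Set.nonempty_Ioo.2 h.lt)
  exact ⟨Nat.find hex, Nat.find_spec hex, fun j hj => Nat.find_min hex hj⟩

/-- The points at the first indices are ordered like the maxima of the subchains they represent,
and different indices represent different subchains. -/
theorem right_le_right_iff {k k' : SubchainKind} {a b a' b' : unitInterval} {i j : ℕ}
    (h : IsMaxInterval 𝒞.Runs k a b) (hi : denseSeq unitInterval i ∈ Set.Ioo a b)
    (hi' : ∀ m < i, denseSeq unitInterval m ∉ Set.Ioo a b)
    (h' : IsMaxInterval 𝒞.Runs k' a' b') (hj : denseSeq unitInterval j ∈ Set.Ioo a' b')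
    (hj' : ∀ m < j, denseSeq unitInterval m ∉ Set.Ioo a' b') :
    (b ≤ b' ↔ denseSeq unitInterval i ≤ denseSeq unitInterval j) ∧ (b = b' → i = j) := by
  have hP := 𝒞.isIntervalSystem_runs
  have hij : b = b' → i = j := by
    rintro rfl
    obtain ⟨-, rfl⟩ := hP.isMaxInterval_eq_of_right_eq h h'
    exact (not_lt.1 fun hlt => hi' j hlt hj).antisymm (not_lt.1 fun hlt => hj' i hlt hi)
  refine ⟨?_, hij⟩
  rcases lt_trichotomy b b' with hb | hb | hb
  · exact iff_of_true hb.le (hi.2.trans_le ((hP.right_le_left_of_lt h h' hb).trans hj.1.le)).le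
  · exact iff_of_true hb.le (hij hb ▸ le_rfl)
  · exact iff_of_false hb.not_ge
      (hj.2.trans_le ((hP.right_le_left_of_lt h' h hb).trans hi.1.le)).not_ge

variable (𝒞) in
theorem recordsSubchains_subchainStructure : RecordsSubchains 𝒞.subchainStructure 𝒞 := by
  classical
  have hP := 𝒞.isIntervalSystem_runs
  -- `top i` is the right end of the maximal interval around the `i`-th point, if there is one
  have htop : ∀ i, ∃ B, ∀ k a b, IsMaxInterval 𝒞.Runs k a b →
      denseSeq unitInterval i ∈ Set.Ioo a b → B = b := by
    intro i
    by_cases h : ∃ k a b, IsMaxInterval 𝒞.Runs k a b ∧ denseSeq unitInterval i ∈ Set.Ioo a b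
    · obtain ⟨k, a, b, h, hi⟩ := h
      exact ⟨b, fun k' a' b' h' hi' =>
        (hP.isMaxInterval_eq h h' (hi.1.trans hi'.2) (hi'.1.trans hi.2)).2.2⟩
    · exact ⟨0, fun k a b h' hi => (h ⟨k, a, b, h', hi⟩).elim⟩
  choose top htop using htop
  let p : ℕ → Prop := fun j => ∃ k, 𝒞.IsFirstIndex k j
  let e : ℕ → Subcontinuum unitInterval := fun n => 𝒞.elt (top (Nat.nth p n))
  have he : ∀ i, p i → e (𝒞.position i) = 𝒞.elt (top i) := fun i hi => by
    change 𝒞.elt (top (Nat.nth p (Nat.count p i))) = _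
    rw [Nat.nth_count hi]
  have hmem : ∀ k i, 𝒞.IsFirstIndex k i → 𝒞.elt (top i) ∈ subchainTops 𝒞 k := by
    rintro k i ⟨a, b, h, hi, -⟩
    rw [htop i k a b h hi]
    exact mem_subchainTops_iff.2 ⟨a, b, h, rfl⟩
  have hcmp : ∀ i j, p i → p j → (𝒞.elt (top i) ≤ 𝒞.elt (top j) ↔
      denseSeq unitInterval i ≤ denseSeq unitInterval j) ∧
      (𝒞.elt (top i) = 𝒞.elt (top j) → i = j) := by
    rintro i j ⟨k, a, b, h, hi, hi'⟩ ⟨k', a', b', h', hj, hj'⟩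
    rw [htop i k a b h hi, htop j k' a' b' h' hj, 𝒞.strictMono_elt.le_iff_le,
      𝒞.elt_injective.eq_iff]
    exact right_le_right_iff h hi hi' h' hj hj'
  refine ⟨{n | ∃ i, p i ∧ 𝒞.position i = n}, e, ⟨?_, ?_, ?_⟩, fun hinf => ?_, fun k n => ?_,
    fun n m => ?_⟩
  · rintro _ ⟨i, ⟨k, hi⟩, rfl⟩
    rw [he i ⟨k, hi⟩]
    exact Set.mem_iUnion.2 ⟨k, hmem k i hi⟩
  · rintro _ ⟨i, hi, rfl⟩ _ ⟨j, hj, rfl⟩ hij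
    rw [he i hi, he j hj] at hij
    rw [(hcmp i j hi hj).2 hij]
  · intro A hA
    obtain ⟨k, hA⟩ := Set.mem_iUnion.1 hA
    obtain ⟨a, b, h, rfl⟩ := mem_subchainTops_iff.1 hA
    obtain ⟨i, hi, hi'⟩ := exists_isFirstIndex h
    have hp : p i := ⟨k, a, b, h, hi, hi'⟩
    exact ⟨_, ⟨i, hp, rfl⟩, by rw [he i hp, htop i k a b h hi]⟩
  · have hpinf : (Set.ofPred p).Infinite := fun hfin => hinf (hfin.image 𝒞.position)
    exact Set.eq_univ_of_forall fun n =>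
      ⟨Nat.nth p n, Nat.nth_mem_of_infinite hpinf n, Nat.count_nth_of_infinite hpinf n⟩
  · refine decide_eq_true_iff.trans ⟨?_, ?_⟩
    · rintro ⟨i, hi, rfl⟩
      rw [he i ⟨k, hi⟩]
      exact ⟨⟨i, ⟨k, hi⟩, rfl⟩, hmem k i hi⟩
    · rintro ⟨⟨i, ⟨k', hi⟩, rfl⟩, h⟩
      rw [he i ⟨k', hi⟩] at h
      obtain rfl := subchainTops_disjoint h (hmem k' i hi)
      exact ⟨i, hi, rfl⟩
  · refine decide_eq_true_iff.trans ⟨?_, ?_⟩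
    · rintro ⟨i, j, hi, hj, hij, rfl, h⟩
      obtain rfl : 𝒞.position j = m := h
      refine ⟨⟨i, hi, rfl⟩, ⟨j, hj, rfl⟩, ?_⟩
      rw [he i hi, he j hj]
      exact (hcmp i j hi hj).1.2 hij
    · rintro ⟨⟨i, hi, rfl⟩, ⟨j, hj, rfl⟩, h⟩
      rw [he i hi, he j hj] at h
      exact ⟨i, j, hi, hj, (hcmp i j hi hj).1.1 h, rfl, rfl⟩

/-! ### Measurability -/

/-- Whether two points lie inside the same maximal interval is decided by the intervals with
endpoints in the dense sequence. -/
theorem isFirstIndex_iff {k : SubchainKind} {i : ℕ} :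
    𝒞.IsFirstIndex k i ↔
      (∃ j l, denseSeq unitInterval j < denseSeq unitInterval i ∧
        denseSeq unitInterval i < denseSeq unitInterval l ∧
        𝒞.Runs k (denseSeq unitInterval j) (denseSeq unitInterval l)) ∧
      ∀ m < i, ¬ ∃ j l, denseSeq unitInterval j < denseSeq unitInterval i ∧
        denseSeq unitInterval i < denseSeq unitInterval l ∧
        denseSeq unitInterval j < denseSeq unitInterval m ∧
        denseSeq unitInterval m < denseSeq unitInterval l ∧
        𝒞.Runs k (denseSeq unitInterval j) (denseSeq unitInterval l) := by
  have hP := 𝒞.isIntervalSystem_runs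
  have hd := denseRange_denseSeq unitInterval
  have hbetween : ∀ s t : unitInterval, s < t → ∃ j, denseSeq unitInterval j ∈ Set.Ioo s t :=
    fun s t h => hd.exists_mem_open isOpen_Ioo (Set.nonempty_Ioo.2 h)
  constructor
  · rintro ⟨a, b, h, hi, hi'⟩
    refine ⟨?_, ?_⟩
    · obtain ⟨j, hj⟩ := hbetween _ _ hi.1
      obtain ⟨l, hl⟩ := hbetween _ _ hi.2
      exact ⟨j, l, hj.2, hl.1, h.holds.mono hj.1.le (hj.2.trans hl.1).le hl.2.le⟩
    · rintro m hm ⟨j, l, hji, hil, hjm, hml, hr⟩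
      have := hP.isMaxInterval_contains h (hji.trans hil) hr (hi.1.trans hil) (hji.trans hi.2)
      exact hi' m hm ⟨this.2.1.trans_lt hjm, hml.trans_le this.2.2⟩
  · rintro ⟨⟨j, l, hji, hil, hr⟩, hfirst⟩
    obtain ⟨a, b, ha, hb, h⟩ := hP.exists_isMaxInterval (hji.trans hil) hr
    refine ⟨a, b, h, ⟨ha.trans_lt hji, hil.trans_le hb⟩, fun m hm hmab => hfirst m hm ?_⟩
    obtain ⟨j', hj'⟩ := hbetween a _ (lt_min (ha.trans_lt hji) hmab.1)
    obtain ⟨l', hl'⟩ := hbetween _ b (max_lt (hil.trans_le hb) hmab.2)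
    have h₁ := lt_min_iff.1 hj'.2
    have h₂ := max_lt_iff.1 hl'.1
    exact ⟨j', l', h₁.1, h₂.1, h₁.2, h₂.2, h.holds.mono hj'.1.le (h₁.1.trans h₂.1).le hl'.2.le⟩

/-- Strict monotonicity needs to be tested on the dense sequence only, as a failure occurs on a whole
interval. -/
theorem runs_strictlyMonotone_iff {s t : unitInterval} :
    𝒞.Runs .strictlyMonotone s t ↔ ∀ m n, s ≤ denseSeq unitInterval m →
      denseSeq unitInterval m < denseSeq unitInterval n → denseSeq unitInterval n ≤ t →
      𝒞.lo (denseSeq unitInterval m) ≠ 𝒞.lo (denseSeq unitInterval n) ∧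
        𝒞.hi (denseSeq unitInterval m) ≠ 𝒞.hi (denseSeq unitInterval n) := by
  refine ⟨fun h m n => h _ _, fun h => ?_⟩
  by_contra hr
  obtain ⟨u, v, hu, huv, hv, he⟩ := not_runs_strictlyMonotone_iff.1 hr
  have hd := denseRange_denseSeq unitInterval
  obtain ⟨m, hm⟩ := hd.exists_mem_open isOpen_Ioo (Set.nonempty_Ioo.2 huv)
  obtain ⟨n, hn⟩ := hd.exists_mem_open isOpen_Ioo (Set.nonempty_Ioo.2 hm.2)
  have hm' : denseSeq unitInterval m ∈ Set.Icc u v := Set.Ioo_subset_Icc_self hm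
  have hn' : denseSeq unitInterval n ∈ Set.Icc u v := ⟨(hm.1.trans hn.1).le, hn.2.le⟩
  have := h m n (hu.trans hm.1).le hn.1 (hn.2.trans hv).le
  rcases he with he | he
  · exact this.1 ((lo_eq_of_mem_Icc he hm').trans (lo_eq_of_mem_Icc he hn').symm)
  · exact this.2 ((hi_eq_of_mem_Icc he hm').trans (hi_eq_of_mem_Icc he hn').symm)

section Borel

local instance : MeasurableSpace (MaximalChain unitInterval) := borel _

local instance : BorelSpace (MaximalChain unitInterval) := ⟨rfl⟩

/-- For fixed `t`, the chains whose element of length `t` lies in a closed set form a closed set. -/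
theorem isClosed_setOf_elt_mem (t : unitInterval) {F : Set (Subcontinuum unitInterval)}
    (hF : IsClosed F) : IsClosed {𝒞 : MaximalChain unitInterval | 𝒞.elt t ∈ F} := by
  have hF' : IsClosed (F ∩ {K | K.length = t}) :=
    hF.inter (isClosed_eq Subcontinuum.continuous_length continuous_const)
  convert (Subcontinuum.isClosed_setOf_inter_nonempty hF').preimage
    (continuous_subtype_val (p := fun 𝒞 : Subcontinuum (Subcontinuum unitInterval) =>
      IsMaxChain (· ≤ ·) ((𝒞 : NonemptyCompacts (Subcontinuum unitInterval)) :
        Set (Subcontinuum unitInterval)))) using 1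
  ext 𝒞
  constructor
  · exact fun h => ⟨𝒞.elt t, 𝒞.elt_mem t, h, 𝒞.length_elt t⟩
  · rintro ⟨K, hK, hKF, rfl⟩
    change 𝒞.elt K.length ∈ F
    rwa [𝒞.elt_length hK]

theorem measurable_lo (t : unitInterval) :
    Measurable fun 𝒞 : MaximalChain unitInterval => 𝒞.lo t :=
  measurable_of_Ici fun _ =>
    (isClosed_setOf_elt_mem t (isClosed_Ici.preimage Subcontinuum.continuous_lo)).measurableSet

theorem measurable_hi (t : unitInterval) :
    Measurable fun 𝒞 : MaximalChain unitInterval => 𝒞.hi t :=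
  measurable_of_Ici fun _ =>
    (isClosed_setOf_elt_mem t (isClosed_Ici.preimage Subcontinuum.continuous_hi)).measurableSet

theorem measurable_runs (k : SubchainKind) (s t : unitInterval) :
    Measurable fun 𝒞 : MaximalChain unitInterval => 𝒞.Runs k s t := by
  have hl : ∀ s t, Measurable fun 𝒞 : MaximalChain unitInterval => 𝒞.lo s = 𝒞.lo t :=
    fun s t => measurableSet_setOfPred.1 (measurableSet_eq_fun (measurable_lo s) (measurable_lo t))
  have hh : ∀ s t, Measurable fun 𝒞 : MaximalChain unitInterval => 𝒞.hi s = 𝒞.hi t :=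
    fun s t => measurableSet_setOfPred.1 (measurableSet_eq_fun (measurable_hi s) (measurable_hi t))
  cases k with
  | horizontal => exact hh s t
  | vertical => exact hl s t
  | strictlyMonotone =>
    simp only [runs_strictlyMonotone_iff]
    exact Measurable.forall fun m => Measurable.forall fun n => measurable_const.imp
      (measurable_const.imp (measurable_const.imp ((hl _ _).not.and (hh _ _).not)))

theorem measurable_isFirstIndex (k : SubchainKind) (i : ℕ) :
    Measurable fun 𝒞 : MaximalChain unitInterval => 𝒞.IsFirstIndex k i := by
  simp only [isFirstIndex_iff]
  refine Measurable.and ?_ ?_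
  · exact Measurable.exists fun j => Measurable.exists fun l =>
      measurable_const.and (measurable_const.and (measurable_runs _ _ _))
  · exact Measurable.forall fun m => measurable_const.imp (Measurable.not
      (Measurable.exists fun j => Measurable.exists fun l => measurable_const.and
        (measurable_const.and (measurable_const.and
          (measurable_const.and (measurable_runs _ _ _))))))

theorem measurable_exists_isFirstIndex (i : ℕ) :
    Measurable fun 𝒞 : MaximalChain unitInterval => ∃ k, 𝒞.IsFirstIndex k i := by
  have : (fun 𝒞 : MaximalChain unitInterval => ∃ k, 𝒞.IsFirstIndex k i) = fun 𝒞 =>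
      𝒞.IsFirstIndex .horizontal i ∨ 𝒞.IsFirstIndex .vertical i ∨
        𝒞.IsFirstIndex .strictlyMonotone i := by
    funext 𝒞
    refine propext ⟨?_, ?_⟩
    · rintro ⟨k, h⟩
      cases k
      exacts [Or.inl h, Or.inr (Or.inl h), Or.inr (Or.inr h)]
    · rintro (h | h | h) <;> exact ⟨_, h⟩
  rw [this]
  exact (measurable_isFirstIndex _ i).or
    ((measurable_isFirstIndex _ i).or (measurable_isFirstIndex _ i))

theorem measurable_position (i : ℕ) :
    Measurable fun 𝒞 : MaximalChain unitInterval => 𝒞.position i := by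
  classical
  induction i with
  | zero => simp only [position, Nat.count_zero]; exact measurable_const
  | succ i ih =>
    simp only [position, Nat.count_succ] at ih ⊢
    exact ih.add (Measurable.ite (measurableSet_setOfPred.2 (measurable_exists_isFirstIndex i))
      measurable_const measurable_const)

theorem measurable_position_eq (i n : ℕ) :
    Measurable fun 𝒞 : MaximalChain unitInterval => 𝒞.position i = n :=
  measurableSet_setOfPred.1 (measurableSet_eq_fun (measurable_position i) measurable_const)

theorem measurableSet_subchainStructure (R : Σ n, subchainLanguage.Relations n)
    (v : Fin R.1 → ℕ) :
    MeasurableSet {𝒞 : MaximalChain unitInterval | 𝒞.subchainStructure R v = true} := by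
  obtain ⟨_, R⟩ := R
  cases R with
  | kind k =>
    simp only [subchainStructure, decide_eq_true_eq]
    exact measurableSet_setOfPred.2 (Measurable.exists fun i =>
      (measurable_isFirstIndex k i).and (measurable_position_eq i _))
  | below =>
    simp only [subchainStructure, decide_eq_true_eq]
    exact measurableSet_setOfPred.2 (Measurable.exists fun i => Measurable.exists fun j =>
      (measurable_exists_isFirstIndex i).and ((measurable_exists_isFirstIndex j).and
        (measurable_const.and ((measurable_position_eq i _).and (measurable_position_eq j _)))))

end Borel

end MaximalChain

/-- As there are only countably many relation symbols, the Borel sets of `Mod(L)` are generated by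
the coordinates. -/
theorem isBorelMap_iff {Y : Type*} [TopologicalSpace Y] {L : FirstOrder.Language.{0, 0}}
    [Countable (Σ n, L.Relations n)] {f : Y → CodedStructure L} :
    IsBorelMap f ↔ ∀ R v, @MeasurableSet Y (borel Y) {y | f y R v = true} := by
  let _ : MeasurableSpace Y := borel Y
  have hpi : borel (CodedStructure L) = MeasurableSpace.pi :=
    (Pi.borelSpace (X := fun R : Σ n, L.Relations n => (Fin R.1 → ℕ) → Bool)).measurable_eq.symm
  unfold IsBorelMap
  rw [hpi, measurable_pi_iff]
  refine forall_congr' fun R => ?_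
  rw [measurable_pi_iff]
  refine forall_congr' fun v => ⟨fun h => h (measurableSet_singleton true), fun h => ?_⟩
  exact measurable_to_bool h

instance : Countable (Σ n, subchainLanguage.Relations n) := by
  let g : ℕ → Σ n, subchainLanguage.Relations n
    | 0 => ⟨1, SubchainRelation.kind .horizontal⟩
    | 1 => ⟨1, SubchainRelation.kind .vertical⟩
    | 2 => ⟨1, SubchainRelation.kind .strictlyMonotone⟩
    | _ => ⟨2, SubchainRelation.below⟩
  refine Function.Surjective.countable (f := g) ?_
  rintro ⟨_, R⟩
  cases R with
  | kind k =>
    cases k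
    exacts [⟨0, rfl⟩, ⟨1, rfl⟩, ⟨2, rfl⟩]
  | below => exact ⟨3, rfl⟩

instance : Countable (Σ n, unorientedLanguage.Relations n) := by
  let g : ℕ → Σ n, unorientedLanguage.Relations n
    | 0 => ⟨2, UnorientedRelation.sameKind⟩
    | _ => ⟨2, UnorientedRelation.below⟩
  refine Function.Surjective.countable (f := g) ?_
  rintro ⟨_, R⟩
  cases R
  exacts [⟨0, rfl⟩, ⟨1, rfl⟩]

theorem isBorelMap_subchainStructure :
    IsBorelMap (MaximalChain.subchainStructure : MaximalChain unitInterval → _) :=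
  isBorelMap_iff.2 MaximalChain.measurableSet_subchainStructure

theorem IsBorelMap.unorient {Y : Type*} [TopologicalSpace Y]
    {f : Y → CodedStructure subchainLanguage} (hf : IsBorelMap f) :
    IsBorelMap fun y => (f y).unorient := by
  let _ : MeasurableSpace Y := borel Y
  rw [isBorelMap_iff] at hf ⊢
  rintro ⟨_, R⟩ v
  cases R with
  | sameKind =>
    simp only [CodedStructure.unorient, Bool.or_eq_true, Bool.and_eq_true]
    exact ((hf _ _).inter (hf _ _)).union ((hf _ _).inter (hf _ _))
  | below => exact hf _ _

theorem theoremA5 :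
    ClassifiableByCountableStructures
      (MulAction.orbitRel (unitInterval ≃ₜ unitInterval) (MaximalChain unitInterval)) ∧
    ∃ M : MaximalChain unitInterval → CodedStructure subchainLanguage,
      IsBorelMap M ∧
      (∀ 𝒞 : MaximalChain unitInterval, RecordsSubchains (M 𝒞) 𝒞) ∧
      ∀ 𝒞 𝒞' : MaximalChain unitInterval,
        (∃ h : unitInterval ≃ₜ unitInterval, StrictMono h ∧ 𝒞' = h • 𝒞) ↔
          (M 𝒞).Isomorphic (M 𝒞') := by
  refine ⟨⟨unorientedLanguage, inferInstance, inferInstance, fun 𝒞 => 𝒞.subchainStructure.unorient,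
    isBorelMap_subchainStructure.unorient, fun 𝒞 𝒟 => ?_⟩, MaximalChain.subchainStructure,
    isBorelMap_subchainStructure, MaximalChain.recordsSubchains_subchainStructure, fun 𝒞 𝒟 =>
      𝒞.recordsSubchains_subchainStructure.exists_strictMono_iff
        𝒟.recordsSubchains_subchainStructure⟩
  rw [← 𝒞.recordsSubchains_subchainStructure.exists_homeomorph_iff
    𝒟.recordsSubchains_subchainStructure]
  exact (Setoid.comm' _).trans (exists_congr fun h => eq_comm)
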